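/- **Setting.** Let $d\in\mathbb N$ and let $\omega:[0,\infty)\to[0,\infty)$ be a non-quasianalytic subadditive weight function: $\omega$ is continuous and increasing (in the weak sense), $\omega(s+t)\le\omega(s)+\omega(t)$, $\int_1^\infty \omega(t)t^{-2}\,dt<\infty$, $\log t=o(\omega(t))$ as $t\to\infty$, and $t\mapsto\omega(e^t)$ is convex. Put $\omega(z):=\omega(|z|)$ for $z\in\mathbb R^n$, and $\hat u(\xi)=\int e^{-i\langle x,\xi\rangle}u(x)\,dx$. The space $\mathcal S_\omega(\mathbb R^d)$ consists of all $u\in\mathcal S(\mathbb R^d)$ such that $\sup_x e^{\lambda\omega(x)}|D^\alpha u(x)|<\infty$ and $\sup_\xi e^{\lambda\omega(\xi)}|D^\alpha\hat u(\xi)|<\infty$ for all $\lambda>0$, $\alpha\in\mathbb N_0^d$, with the topology given by these seminorms; $\mathcal S'_\omega(\mathbb R^d)$ is the space of continuous linear functionals on it, and $\langle u,f\rangle:=u(\overline f)$ for $u\in\mathcal S'_\omega$, $f\in\mathcal S_\omega$. For $z=(x,\xi)\in\mathbb R^{2d}$ let $\Pi(z)f(y)=e^{i\langle y,\xi\rangle}f(y-x)$,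 and let $V_\varphi u(z)=\langle u,\Pi(z)\varphi\rangle$ for $u\in\mathcal S'_\omega(\mathbb R^d)$, respectively $V_\varphi g(z)=\int g\,\overline{\Pi(z)\varphi}\,dy$ for $g\in\mathcal S_\omega(\mathbb R^d)$, be the short-time Fourier transform with window $\varphi\in\mathcal S_\omega(\mathbb R^d)\setminus\{0\}$. A point $z_0\in\mathbb R^{2d}\setminus\{0\}$ is not in the wave front set $\mathrm{WF}'_\omega(u)$ of $u\in\mathcal S'_\omega(\mathbb R^d)$, computed with the window $\varphi$, if there is an open conic set $\Gamma\subseteq\mathbb R^{2d}\setminus\{0\}$ containing $z_0$ with $\sup_{z\in\Gamma}e^{\lambda\omega(z)}|V_\varphi u(z)|<\infty$ for all $\lambda>0$. **Theorem.** Let $\psi,\gamma\in\mathcal S_\omega(\mathbb R^d)\setminus\{0\}$ and let $a:\mathbb R^{2d}\to\mathbb C$ be a (Lebesgue) measurable function such that, for some $\tau,C>0$, $|a(z)|\le Ce^{\tau\omega(z)}$ for all $z\in\mathbb R^{2d}$. Let $u\in\mathcal S'_\omega(\mathbb R^d)$. Then there is exactly one $L^a_{\psi,\gamma}u=V_\gamma^*(a\cdot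 V_\psi u)\in\mathcal S'_\omega(\mathbb R^d)$ such that for every $g\in\mathcal S_\omega(\mathbb R^d)$ $$\langle L^a_{\psi,\gamma}u,g\rangle=\int_{\mathbb R^{2d}}a(z)\,V_\psi u(z)\,\overline{V_\gamma g(z)}\,dz ,$$ the integral being absolutely convergent, and $$\mathrm{WF}'_\omega(L^a_{\psi,\gamma}u)\subseteq\mathrm{WF}'_\omega(u),$$ where the two wave front sets may be computed with arbitrary, possibly different, windows in $\mathcal S_\omega(\mathbb R^d)\setminus\{0\}$. -/

import Mathlib

open MeasureTheory Set Filter Topology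
open scoped SchwartzMap

noncomputable section

namespace GaborWF

/-- The Euclidean space `ℝ^d`. -/
abbrev Euc (d : ℕ) : Type := EuclideanSpace ℝ (Fin d)

/-- Non-quasianalytic subadditive weight functions `ω : [0,∞) → [0,∞)`. Only the values on
`[0,∞)` are constrained and only these are used below. -/
structure Weight where
  toFun : ℝ → ℝ
  nonneg : ∀ t, 0 ≤ t → 0 ≤ toFun t
  continuousOn : ContinuousOn toFun (Ici 0)
  monotoneOn : MonotoneOn toFun (Ici 0)
  subadd : ∀ s t, 0 ≤ s → 0 ≤ t → toFun (s + t) ≤ toFun s + toFun t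
  integrable : IntegrableOn (fun t => toFun t / t ^ 2) (Ioi 1)
  log_isLittleO : Real.log =o[atTop] toFun
  convex_exp : ConvexOn ℝ univ (fun t => toFun (Real.exp t))

instance : CoeFun Weight (fun _ => ℝ → ℝ) := ⟨Weight.toFun⟩

/-- The Fourier transform `∫ e^{-i⟨x,ξ⟩} f(x) dx`. -/
def angFourier {d : ℕ} (f : Euc d → ℂ) (ξ : Euc d) : ℂ :=
  ∫ x, Complex.exp (-(Complex.I * (inner ℝ x ξ : ℝ))) * f x

/-- All derivatives of `f` decay faster than `e^{-lω(x)}` for every `l > 0`: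
`sup_x e^{lω(|x|)} |D^n f(x)| < ∞` for every order `n`. -/
def RapidDecay {d : ℕ} (ω : ℝ → ℝ) (f : Euc d → ℂ) : Prop :=
  ∀ l : ℝ, 0 < l → ∀ n : ℕ,
    BddAbove (range fun x => Real.exp (l * ω ‖x‖) * ‖iteratedFDeriv ℝ n f x‖)

lemma angFourier_eq {d : ℕ} (u : 𝓢(Euc d, ℂ)) :
    angFourier (u : Euc d → ℂ) =
      fun ξ => (FourierTransform.fourier u : 𝓢(Euc d, ℂ)) ((2 * Real.pi)⁻¹ • ξ) := by
  funext ξ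
  rw [SchwartzMap.fourier_coe, Real.fourier_eq', angFourier]
  congr 1
  funext x
  rw [smul_eq_mul]
  congr 2
  rw [inner_smul_right]
  have : (Real.pi : ℂ) ≠ 0 := by exact_mod_cast Real.pi_ne_zero
  push_cast
  field_simp

lemma contDiff_angFourier {d : ℕ} (u : 𝓢(Euc d, ℂ)) (n : ℕ∞) :
    ContDiff ℝ n (angFourier (u : Euc d → ℂ)) := by
  rw [angFourier_eq]
  exact ((FourierTransform.fourier u : 𝓢(Euc d, ℂ)).smooth n).comp (contDiff_const_smul _)

lemma angFourier_add {d : ℕ} (u v : 𝓢(Euc d, ℂ)) :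
    angFourier ((u + v : 𝓢(Euc d, ℂ)) : Euc d → ℂ) =
      angFourier (u : Euc d → ℂ) + angFourier (v : Euc d → ℂ) := by
  simp only [angFourier_eq, FourierTransform.fourier_add]
  rfl

lemma angFourier_smul {d : ℕ} (c : ℂ) (u : 𝓢(Euc d, ℂ)) :
    angFourier ((c • u : 𝓢(Euc d, ℂ)) : Euc d → ℂ) = c • angFourier (u : Euc d → ℂ) := by
  simp only [angFourier_eq, FourierTransform.fourier_smul]
  rfl

lemma RapidDecay.add {d : ℕ} {ω : ℝ → ℝ} {f g : Euc d → ℂ} (hf : RapidDecay ω f)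
    (hg : RapidDecay ω g) (cf : ∀ n : ℕ, ContDiff ℝ n f) (cg : ∀ n : ℕ, ContDiff ℝ n g) :
    RapidDecay ω (f + g) := by
  intro l hl n
  obtain ⟨A, hA⟩ := hf l hl n
  obtain ⟨B, hB⟩ := hg l hl n
  refine ⟨A + B, ?_⟩
  rintro _ ⟨x, rfl⟩
  have h1 := hA ⟨x, rfl⟩
  have h2 := hB ⟨x, rfl⟩
  simp only at h1 h2 ⊢
  rw [iteratedFDeriv_add_apply (cf n).contDiffAt (cg n).contDiffAt]
  calc _ ≤ Real.exp (l * ω ‖x‖) * (‖iteratedFDeriv ℝ n f x‖ + ‖iteratedFDeriv ℝ n g x‖) := by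
        gcongr; exact norm_add_le _ _
    _ ≤ A + B := by rw [mul_add]; exact add_le_add h1 h2

lemma RapidDecay.smul {d : ℕ} {ω : ℝ → ℝ} {f : Euc d → ℂ} (hf : RapidDecay ω f)
    (cf : ∀ n : ℕ, ContDiff ℝ n f) (c : ℂ) : RapidDecay ω (c • f) := by
  intro l hl n
  obtain ⟨A, hA⟩ := hf l hl n
  refine ⟨‖c‖ * A, ?_⟩
  rintro _ ⟨x, rfl⟩
  have h1 := hA ⟨x, rfl⟩
  simp only at h1 ⊢
  rw [iteratedFDeriv_const_smul_apply (cf n).contDiffAt, norm_smul, mul_left_comm]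
  gcongr

/-- The subspace of those `u` in the Schwartz space for which `u` and its Fourier transform, with
all their derivatives, decay faster than `e^{-lω}` for every `l > 0`. -/
def omegaSubmodule (ω : Weight) (d : ℕ) : Submodule ℂ 𝓢(Euc d, ℂ) where
  carrier := {u | RapidDecay ω (u : Euc d → ℂ) ∧ RapidDecay ω (angFourier (u : Euc d → ℂ))}
  zero_mem' := by
    have h : RapidDecay ω (0 : Euc d → ℂ) := by
      intro l _ n
      refine ⟨0, ?_⟩
      rintro _ ⟨x, rfl⟩
      simp
    refine ⟨h, ?_⟩
    have : angFourier ((0 : 𝓢(Euc d, ℂ)) : Euc d → ℂ) = 0 := by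
      funext ξ
      simp [angFourier]
    rw [this]
    exact h
  add_mem' := by
    intro u v hu hv
    refine ⟨hu.1.add hv.1 (fun n => u.smooth n) (fun n => v.smooth n), ?_⟩
    rw [angFourier_add]
    exact hu.2.add hv.2 (fun n => contDiff_angFourier u n) (fun n => contDiff_angFourier v n)
  smul_mem' := by
    intro c u hu
    refine ⟨hu.1.smul (fun n => u.smooth n) c, ?_⟩
    rw [angFourier_smul]
    exact hu.2.smul (fun n => contDiff_angFourier u n) c

/-- The space `𝒮_ω(ℝ^d)`. This is a type synonym, so that it carries its own topology below and
not the subspace topology of the Schwartz space. -/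
def SOmega (ω : Weight) (d : ℕ) : Type := omegaSubmodule ω d

namespace SOmega

variable {ω : Weight} {d : ℕ}

instance : AddCommGroup (SOmega ω d) := inferInstanceAs (AddCommGroup (omegaSubmodule ω d))

instance : Module ℂ (SOmega ω d) := inferInstanceAs (Module ℂ (omegaSubmodule ω d))

/-- The underlying Schwartz function. -/
def toSchwartz (u : SOmega ω d) : 𝓢(Euc d, ℂ) := Subtype.val u

instance : CoeFun (SOmega ω d) (fun _ => Euc d → ℂ) := ⟨fun u => u.toSchwartz⟩

lemma decay (u : SOmega ω d) : RapidDecay ω u := u.property.1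

lemma decay_fourier (u : SOmega ω d) : RapidDecay ω (angFourier u) := u.property.2

/-- The seminorm `sup_x e^{lω(x)} |D^n u(x)|`. -/
def spaceSeminorm (l : Ioi (0 : ℝ)) (n : ℕ) : Seminorm ℂ (SOmega ω d) :=
  Seminorm.of (fun u => ⨆ x, Real.exp (l * ω ‖x‖) * ‖iteratedFDeriv ℝ n u x‖)
    (by
      intro u v
      refine ciSup_le fun x => ?_
      have h1 := le_ciSup (u.decay l l.2 n) x
      have h2 := le_ciSup (v.decay l l.2 n) x
      refine le_trans ?_ (add_le_add h1 h2)
      rw [← mul_add]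
      gcongr
      refine le_trans (le_of_eq ?_) (norm_add_le _ _)
      rw [← iteratedFDeriv_add_apply (u.toSchwartz.smooth n).contDiffAt
        (v.toSchwartz.smooth n).contDiffAt]
      rfl)
    (by
      intro c u
      rw [Real.mul_iSup_of_nonneg (norm_nonneg c)]
      congr 1
      funext x
      rw [mul_left_comm, ← norm_smul, ← iteratedFDeriv_const_smul_apply
        (u.toSchwartz.smooth n).contDiffAt]
      rfl)

/-- The seminorm `sup_ξ e^{lω(ξ)} |D^n û(ξ)|`. -/
def freqSeminorm (l : Ioi (0 : ℝ)) (n : ℕ) : Seminorm ℂ (SOmega ω d) :=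
  Seminorm.of (fun u => ⨆ ξ, Real.exp (l * ω ‖ξ‖) * ‖iteratedFDeriv ℝ n (angFourier u) ξ‖)
    (by
      intro u v
      refine ciSup_le fun x => ?_
      have h1 := le_ciSup (u.decay_fourier l l.2 n) x
      have h2 := le_ciSup (v.decay_fourier l l.2 n) x
      refine le_trans ?_ (add_le_add h1 h2)
      rw [← mul_add]
      gcongr
      refine le_trans (le_of_eq ?_) (norm_add_le _ _)
      rw [← iteratedFDeriv_add_apply (contDiff_angFourier u.toSchwartz n).contDiffAt
        (contDiff_angFourier v.toSchwartz n).contDiffAt]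
      exact congrArg (fun f => ‖iteratedFDeriv ℝ n f x‖)
        (angFourier_add u.toSchwartz v.toSchwartz))
    (by
      intro c u
      rw [Real.mul_iSup_of_nonneg (norm_nonneg c)]
      congr 1
      funext x
      rw [mul_left_comm, ← norm_smul, ← iteratedFDeriv_const_smul_apply
        (contDiff_angFourier u.toSchwartz n).contDiffAt]
      exact congrArg (fun f => _ * ‖iteratedFDeriv ℝ n f x‖)
        (angFourier_smul c u.toSchwartz))

/-- The defining family of seminorms of `𝒮_ω(ℝ^d)`. -/
def seminormFamily (ω : Weight) (d : ℕ) :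
    SeminormFamily ℂ (SOmega ω d) ((Ioi (0 : ℝ) × ℕ) ⊕ (Ioi (0 : ℝ) × ℕ)) :=
  Sum.elim (fun i => spaceSeminorm i.1 i.2) (fun i => freqSeminorm i.1 i.2)

instance : Nonempty ((Ioi (0 : ℝ) × ℕ) ⊕ (Ioi (0 : ℝ) × ℕ)) := ⟨Sum.inl (⟨1, zero_lt_one' ℝ⟩, 0)⟩

/-- The locally convex topology of `𝒮_ω(ℝ^d)`. -/
instance : TopologicalSpace (SOmega ω d) :=
  (seminormFamily ω d).moduleFilterBasis.topology

lemma withSeminorms : WithSeminorms (seminormFamily ω d) := ⟨rfl⟩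

end SOmega

/-- The space `𝒮'_ω(ℝ^d)` of `ω`-tempered distributions: continuous linear functionals. -/
abbrev DOmega (ω : Weight) (d : ℕ) : Type := SOmega ω d →L[ℂ] ℂ

/-- The function `y ↦ e^{i⟨y,ξ⟩}`. -/
def character {d : ℕ} (ξ : Euc d) (y : Euc d) : ℂ :=
  Complex.exp (Complex.I * (inner ℝ y ξ : ℝ))

/-- The phase-space shift `Π(z)f(y) = e^{i⟨y,ξ⟩} f(y - x)`, `z = (x,ξ)`. -/
def shiftFun {d : ℕ} (z : Euc d × Euc d) (f : Euc d → ℂ) (y : Euc d) : ℂ :=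
  character z.2 y * f (y - z.1)

lemma contDiff_character {d : ℕ} (ξ : Euc d) (n : WithTop ℕ∞) :
    ContDiff ℝ n (character ξ) := by
  unfold character
  exact (contDiff_const.mul (Complex.ofRealCLM.contDiff.comp
    (contDiff_id.inner ℝ contDiff_const))).cexp

lemma norm_iteratedFDeriv_character_le {d : ℕ} (ξ : Euc d) (n : ℕ) (y : Euc d) :
    ‖iteratedFDeriv ℝ n (character ξ) y‖ ≤ ‖ξ‖ ^ n := by
  have key : ∀ m : ℕ, iteratedDeriv m (fun t : ℝ => Complex.exp (Complex.I * t)) =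
      fun t : ℝ => Complex.I ^ m * Complex.exp (Complex.I * t) := by
    intro m
    induction m with
    | zero => simp
    | succ m ih =>
      rw [iteratedDeriv_succ, ih]
      funext t
      have h : HasDerivAt (fun t : ℝ => Complex.exp (Complex.I * t))
          (Complex.exp (Complex.I * t) * (Complex.I * 1)) t :=
        ((Complex.ofRealCLM.hasDerivAt (x := t)).const_mul Complex.I).cexp
      rw [(h.const_mul _).deriv]
      ring
  have hc : ContDiff ℝ n (fun t : ℝ => Complex.exp (Complex.I * t)) :=
    (contDiff_const.mul Complex.ofRealCLM.contDiff).cexp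
  have hch : character ξ =
      (fun t : ℝ => Complex.exp (Complex.I * t)) ∘ (innerSL ℝ ξ) := by
    funext y
    simp [character, real_inner_comm]
  rw [hch, ContinuousLinearMap.iteratedFDeriv_comp_right _ hc _ le_rfl]
  refine (ContinuousMultilinearMap.norm_compContinuousLinearMap_le _ _).trans ?_
  rw [norm_iteratedFDeriv_eq_norm_iteratedDeriv, key]
  simp [Complex.norm_exp]

lemma hasTemperateGrowth_character {d : ℕ} (ξ : Euc d) :
    Function.HasTemperateGrowth (character ξ) := by
  refine ⟨contDiff_character ξ _, fun n => ⟨0, ‖ξ‖ ^ n, fun y => ?_⟩⟩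
  simpa using norm_iteratedFDeriv_character_le ξ n y

lemma RapidDecay.comp_sub {d : ℕ} {ω : Weight} {f : Euc d → ℂ} (hf : RapidDecay ω f)
    (a : Euc d) : RapidDecay ω (fun y => f (y - a)) := by
  intro l hl n
  obtain ⟨A, hA⟩ := hf l hl n
  refine ⟨Real.exp (l * ω ‖a‖) * A, ?_⟩
  rintro _ ⟨x, rfl⟩
  have h1 := hA ⟨x - a, rfl⟩
  simp only at h1 ⊢
  rw [iteratedFDeriv_comp_sub]
  have h2 : ω ‖x‖ ≤ ω ‖a‖ + ω ‖x - a‖ := by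
    refine le_trans (ω.monotoneOn (norm_nonneg _) (add_nonneg (norm_nonneg a)
      (norm_nonneg (x - a))) ?_) (ω.subadd _ _ (norm_nonneg _) (norm_nonneg _))
    simpa using norm_add_le a (x - a)
  calc Real.exp (l * ω ‖x‖) * ‖iteratedFDeriv ℝ n f (x - a)‖
      ≤ Real.exp (l * (ω ‖a‖ + ω ‖x - a‖)) * ‖iteratedFDeriv ℝ n f (x - a)‖ := by gcongr
    _ = Real.exp (l * ω ‖a‖) *
          (Real.exp (l * ω ‖x - a‖) * ‖iteratedFDeriv ℝ n f (x - a)‖) := by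
        rw [mul_add, Real.exp_add]; ring
    _ ≤ _ := by gcongr

lemma RapidDecay.character_mul {d : ℕ} {ω : ℝ → ℝ} {f : Euc d → ℂ} (hf : RapidDecay ω f)
    (cf : ∀ n : ℕ, ContDiff ℝ n f) (ξ : Euc d) :
    RapidDecay ω (fun y => character ξ y * f y) := by
  intro l hl n
  choose A hA using fun k => hf l hl k
  refine ⟨∑ i ∈ Finset.range (n + 1), (n.choose i : ℝ) * ‖ξ‖ ^ i * A (n - i), ?_⟩
  rintro _ ⟨x, rfl⟩
  simp only
  calc _ ≤ Real.exp (l * ω ‖x‖) * ∑ i ∈ Finset.range (n + 1), (n.choose i : ℝ) *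
          ‖iteratedFDeriv ℝ i (character ξ) x‖ * ‖iteratedFDeriv ℝ (n - i) f x‖ := by
        gcongr
        exact norm_iteratedFDeriv_mul_le (contDiff_character ξ n) (cf n) x le_rfl
    _ ≤ _ := by
        rw [Finset.mul_sum]
        refine Finset.sum_le_sum fun i _ => ?_
        have h1 := hA (n - i) ⟨x, rfl⟩
        simp only at h1
        have h2 := norm_iteratedFDeriv_character_le ξ i x
        calc _ = (n.choose i : ℝ) * ‖iteratedFDeriv ℝ i (character ξ) x‖ *
              (Real.exp (l * ω ‖x‖) * ‖iteratedFDeriv ℝ (n - i) f x‖) := by ring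
          _ ≤ _ := by gcongr

lemma RapidDecay.conj {d : ℕ} {ω : ℝ → ℝ} {f : Euc d → ℂ} (hf : RapidDecay ω f) :
    RapidDecay ω (fun y => starRingEnd ℂ (f y)) := by
  intro l hl n
  have : ∀ x, ‖iteratedFDeriv ℝ n (fun y => starRingEnd ℂ (f y)) x‖ =
      ‖iteratedFDeriv ℝ n f x‖ := fun x =>
    Complex.conjLIE.norm_iteratedFDeriv_comp_left f x n
  simp only [this]
  exact hf l hl n

lemma RapidDecay.comp_neg {d : ℕ} {ω : ℝ → ℝ} {f : Euc d → ℂ} (hf : RapidDecay ω f) :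
    RapidDecay ω (fun y => f (-y)) := by
  intro l hl n
  obtain ⟨A, hA⟩ := hf l hl n
  refine ⟨A, ?_⟩
  rintro _ ⟨x, rfl⟩
  have h1 := hA ⟨-x, rfl⟩
  have h2 : ‖iteratedFDeriv ℝ n (fun y => f (-y)) x‖ = ‖iteratedFDeriv ℝ n f (-x)‖ :=
    (LinearIsometryEquiv.neg ℝ (E := Euc d)).norm_iteratedFDeriv_comp_right f x n
  simp only [norm_neg] at h1 ⊢
  rwa [h2]

lemma angFourier_shiftFun {d : ℕ} (z : Euc d × Euc d) (f : Euc d → ℂ) (η : Euc d) :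
    angFourier (shiftFun z f) η = Complex.exp (Complex.I * (inner ℝ z.1 z.2 : ℝ)) *
      (character (-z.1) η * angFourier f (η - z.2)) := by
  unfold angFourier shiftFun character
  rw [← mul_assoc, ← integral_const_mul, ← integral_add_right_eq_self _ z.1]
  congr 1
  funext y
  rw [← mul_assoc, ← mul_assoc, ← Complex.exp_add, ← Complex.exp_add, ← Complex.exp_add]
  rw [real_inner_comm (-z.1) η, add_sub_cancel_right]
  congr 2
  simp only [inner_add_left, inner_sub_right, inner_neg_left]
  push_cast
  ring

lemma angFourier_conj {d : ℕ} (f : Euc d → ℂ) (η : Euc d) :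
    angFourier (fun y => starRingEnd ℂ (f y)) η = starRingEnd ℂ (angFourier f (-η)) := by
  unfold angFourier
  rw [← integral_conj]
  congr 1
  funext y
  rw [map_mul, ← Complex.exp_conj]
  simp [inner_neg_right]

namespace SOmega

variable {ω : Weight} {d : ℕ}

/-- Complex conjugation on `𝒮_ω(ℝ^d)`. -/
def conj (u : SOmega ω d) : SOmega ω d :=
  ⟨SchwartzMap.postcompCLM (𝕜 := ℝ) (Complex.conjCLE : ℂ →L[ℝ] ℂ) u.toSchwartz, by
    refine ⟨u.decay.conj, ?_⟩
    have h : angFourier (fun y => starRingEnd ℂ (u y)) =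
        fun η => starRingEnd ℂ (angFourier u (-η)) := funext (angFourier_conj u)
    change RapidDecay ω (angFourier (fun y => starRingEnd ℂ (u y)))
    rw [h]
    exact u.decay_fourier.comp_neg.conj⟩

lemma conj_apply (u : SOmega ω d) (y : Euc d) : u.conj y = starRingEnd ℂ (u y) := rfl

/-- The phase-space shift `Π(z)` as an operator on `𝒮_ω(ℝ^d)`. -/
def shift (z : Euc d × Euc d) (u : SOmega ω d) : SOmega ω d :=
  ⟨SchwartzMap.smulLeftCLM ℂ (character z.2)
    (SchwartzMap.compSubConstCLM ℂ z.1 u.toSchwartz), by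
    have h : ((SchwartzMap.smulLeftCLM ℂ (character z.2)
        (SchwartzMap.compSubConstCLM ℂ z.1 u.toSchwartz) : 𝓢(Euc d, ℂ)) : Euc d → ℂ) =
        shiftFun z u := by
      funext y
      rw [SchwartzMap.smulLeftCLM_apply_apply (hasTemperateGrowth_character z.2)]
      rfl
    change RapidDecay ω _ ∧ RapidDecay ω _
    rw [h]
    have c1 : ∀ n : ℕ, ContDiff ℝ n fun y => u (y - z.1) := fun n =>
      (u.toSchwartz.smooth n).comp (contDiff_id.sub contDiff_const)
    have c2 : ∀ n : ℕ, ContDiff ℝ n fun η => angFourier u (η - z.2) := fun n =>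
      (contDiff_angFourier u.toSchwartz n).comp (contDiff_id.sub contDiff_const)
    refine ⟨(u.decay.comp_sub z.1).character_mul c1 z.2, ?_⟩
    have h2 : angFourier (shiftFun z u) = Complex.exp (Complex.I * (inner ℝ z.1 z.2 : ℝ)) •
        fun η => character (-z.1) η * angFourier u (η - z.2) :=
      funext (angFourier_shiftFun z u)
    rw [h2]
    exact ((u.decay_fourier.comp_sub z.2).character_mul c2 _).smul
      (fun n => (contDiff_character _ n).mul (c2 n)) _⟩

lemma shift_apply (z : Euc d × Euc d) (u : SOmega ω d) (y : Euc d) :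
    (u.shift z) y = character z.2 y * u (y - z.1) := by
  change (SchwartzMap.smulLeftCLM ℂ (character z.2)
    (SchwartzMap.compSubConstCLM ℂ z.1 u.toSchwartz) : 𝓢(Euc d, ℂ)) y = _
  rw [SchwartzMap.smulLeftCLM_apply_apply (hasTemperateGrowth_character z.2)]
  rfl

end SOmega

variable {ω : Weight} {d : ℕ}

/-- The conjugate-linear action `⟨u, f⟩ = u(f̄)` of `𝒮'_ω` on `𝒮_ω`; it is the `L²` inner product
`∫ u f̄` when `u` is a function. -/
def pairing (u : DOmega ω d) (f : SOmega ω d) : ℂ := u f.conj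

/-- The short-time Fourier transform `V_φ u(z) = ⟨u, Π(z)φ⟩` of `u ∈ 𝒮'_ω`. -/
def stft (φ : SOmega ω d) (u : DOmega ω d) (z : Euc d × Euc d) : ℂ :=
  pairing u (φ.shift z)

/-- The short-time Fourier transform `V_φ g(z) = ∫ g(y) conj(Π(z)φ(y)) dy` of `g ∈ 𝒮_ω`. -/
def stftFun (φ g : SOmega ω d) (z : Euc d × Euc d) : ℂ :=
  ∫ y, g y * starRingEnd ℂ (φ.shift z y)

/-- `v = V_γ^* F = ∫ F(z) Π(z)γ dz` in the weak sense:
`⟨v, g⟩ = ∫ F(z) ⟨Π(z)γ, g⟩ dz = ∫ F(z) conj(V_γ g(z)) dz`, with an absolutely convergent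
integral, for every `g ∈ 𝒮_ω`. -/
def IsAdjointSTFT (γ : SOmega ω d) (F : Euc d × Euc d → ℂ) (v : DOmega ω d) : Prop :=
  ∀ g : SOmega ω d, Integrable (fun z => F z * starRingEnd ℂ (stftFun γ g z)) ∧
    pairing v g = ∫ z, F z * starRingEnd ℂ (stftFun γ g z)

/-- `v = L^a_{ψ,γ} u = V_γ^*(a · V_ψ u)`. -/
def IsLocalization (a : Euc d × Euc d → ℂ) (ψ γ : SOmega ω d) (u v : DOmega ω d) : Prop :=
  IsAdjointSTFT γ (fun z => a z * stft ψ u z) v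

/-- The Euclidean norm on `ℝ^{2d} = ℝ^d × ℝ^d`. -/
def phaseNorm (z : Euc d × Euc d) : ℝ := Real.sqrt (‖z.1‖ ^ 2 + ‖z.2‖ ^ 2)

/-- Open conic subsets of `ℝ^{2d} ∖ {0}`. -/
def IsOpenCone (Γ : Set (Euc d × Euc d)) : Prop :=
  IsOpen Γ ∧ 0 ∉ Γ ∧ ∀ z ∈ Γ, ∀ t : ℝ, 0 < t → t • z ∈ Γ

/-- The `ω`-wave front set `WF'_ω(u)`, computed with the window `φ`. -/
def waveFrontSet (φ : SOmega ω d) (u : DOmega ω d) : Set (Euc d × Euc d) :=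
  {z₀ | z₀ ≠ 0 ∧ ¬ ∃ Γ : Set (Euc d × Euc d), IsOpenCone Γ ∧ z₀ ∈ Γ ∧
    ∀ l : ℝ, 0 < l → BddAbove ((fun z => Real.exp (l * ω (phaseNorm z)) * ‖stft φ u z‖) '' Γ)}

end GaborWF

end

noncomputable section

namespace GaborWF

set_option maxSynthPendingDepth 3

variable {ω : Weight} {d : ℕ}

/-! ### Weights -/

namespace Weight

/-! The proof weighs growth against decay on phase space. A distribution `u` is bounded by finitely
many seminorms, so `V_ψ u` is continuous and grows at most like `e^{μω}` (`continuous_stft`,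
`exists_norm_stft_le`). For `g` in `𝒮_ω` the transform `V_γ g` decays faster than every `e^{-lω}`,
with a constant controlled by seminorms of `g` (`exists_norm_stftFun_le`). Hence `∫ F · conj (V_γ
g)` converges absolutely and is continuous in `g` whenever `F` has exponential growth in `ω`. This
gives the localized distribution (`exists_isAdjointSTFT`). Uniqueness holds because the pairing
determines the functional.

For the wave front set, testing `V_γ^* F` against `Π(z)φ` and using covariance of the transform
bounds `|V_φ (V_γ^* F)(z)|` by `∫ |F(w)| |V_γ φ(w - z)| dw`. If `F` decays rapidly on a cone `Γ` and
`z` lies in a smaller cone, the points `w ∈ Γ` contribute little because `F` is small there. The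
points `w ∉ Γ` contribute little because `|z| ≤ N |z - w|`, so the kernel outweighs the growth of
`F`. This is `IsAdjointSTFT.exists_rapidOn`. Multiplication by `a` costs only a factor `e^{τω}` and
so preserves rapid decay.

Window independence comes from the same lemma with `F = V_θ u`, since `V_θ^* V_θ u` is a nonzero
multiple of `u` (`isAdjointSTFT_stft`). This reconstruction formula is Fourier inversion for test
functions. To apply `u` under the integral, finitely many weighted derivatives embed `𝒮_ω` in a
Banach space of bounded continuous functions, where `u` extends by Hahn–Banach (`exists_extension`)
and the formula becomes an identity of Bochner integrals. -/

lemma apply_norm_nonneg (ω : Weight) (x : Euc d) : 0 ≤ ω ‖x‖ := ω.nonneg _ (norm_nonneg _)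

lemma apply_norm_add_le (ω : Weight) (x y : Euc d) : ω ‖x + y‖ ≤ ω ‖x‖ + ω ‖y‖ :=
  (ω.monotoneOn (norm_nonneg _) (add_nonneg (norm_nonneg x) (norm_nonneg y))
    (norm_add_le x y)).trans (ω.subadd _ _ (norm_nonneg _) (norm_nonneg _))

lemma apply_norm_le_add_sub (ω : Weight) (x y : Euc d) : ω ‖x‖ ≤ ω ‖y‖ + ω ‖x - y‖ := by
  simpa using ω.apply_norm_add_le y (x - y)

lemma continuous_apply_norm (ω : Weight) : Continuous fun x : Euc d => ω ‖x‖ :=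
  ω.continuousOn.comp_continuous continuous_norm fun _ => norm_nonneg _

lemma continuous_exp_mul_norm (ω : Weight) (l : ℝ) :
    Continuous fun x : Euc d => Real.exp (l * ω ‖x‖) :=
  Real.continuous_exp.comp (continuous_const.mul ω.continuous_apply_norm)

/-- Polynomials are dominated by `e^ω`. -/
lemma exists_one_add_pow_le (ω : Weight) (n : ℕ) :
    ∃ C : ℝ, 0 < C ∧ ∀ t : ℝ, 0 ≤ t → (1 + t) ^ n ≤ C * Real.exp (ω t) := by
  -- This constant turns `log t = o(ω(t))` into `(n + 1) log t ≤ ω t`, hence `t ^ n ≤ e^{ω t}` for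
  -- large `t`; `n + 1` avoids a division by zero at `n = 0`.
  have h := ω.log_isLittleO.def (c := 1 / (n + 1)) (by positivity)
  obtain ⟨T, hT⟩ := eventually_atTop.1 h
  set S := max T 1 with hS
  have hS1 : 1 ≤ S := le_max_right _ _
  refine ⟨(1 + S) ^ n + 2 ^ n, by positivity, fun t ht => ?_⟩
  have he : 1 ≤ Real.exp (ω t) := Real.one_le_exp (ω.nonneg t ht)
  rcases le_total t S with hts | hts
  · calc (1 + t) ^ n ≤ (1 + S) ^ n := by gcongr
      _ ≤ ((1 + S) ^ n + 2 ^ n) * 1 := by rw [mul_one]; linarith [pow_pos (zero_lt_two' ℝ) n]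
      _ ≤ _ := by gcongr
  · have ht1 : 1 ≤ t := hS1.trans hts
    have h1 := hT t ((le_max_left _ _).trans hts)
    rw [Real.norm_of_nonneg (Real.log_nonneg ht1), Real.norm_of_nonneg (ω.nonneg t ht)] at h1
    have h2 : n * Real.log t ≤ ω t := by
      have h3 : (n + 1 : ℝ) * Real.log t ≤ ω t := by
        calc (n + 1 : ℝ) * Real.log t ≤ (n + 1) * (1 / (n + 1) * ω t) := by gcongr
          _ = ω t := by field_simp
      linarith [Real.log_nonneg ht1]
    have h4 : t ^ n ≤ Real.exp (ω t) := by
      rw [← Real.exp_log (by positivity : 0 < t ^ n), Real.log_pow]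
      exact Real.exp_le_exp.2 h2
    calc (1 + t) ^ n ≤ (2 * t) ^ n := by gcongr; linarith
      _ = 2 ^ n * t ^ n := mul_pow _ _ _
      _ ≤ 2 ^ n * Real.exp (ω t) := by gcongr
      _ ≤ _ := by gcongr; linarith [show 0 < (1 + S) ^ n by positivity]

/-- `e^{-ω ∘ N}` is integrable for every continuous `N` that dominates the norm. -/
lemma integrable_exp_neg_of_le {E : Type*} [NormedAddCommGroup E] [NormedSpace ℝ E]
    [FiniteDimensional ℝ E] [MeasurableSpace E] [BorelSpace E] (μ : Measure E)
    [μ.IsAddHaarMeasure] (ω : Weight) (N : E → ℝ) (hN : Continuous N) (hle : ∀ x, ‖x‖ ≤ N x) :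
    Integrable (fun x => Real.exp (-ω (N x))) μ := by
  obtain ⟨C, hC, h⟩ := ω.exists_one_add_pow_le (Module.finrank ℝ E + 1)
  have hi := (integrable_one_add_norm (E := E) (μ := μ)
    (r := ((Module.finrank ℝ E + 1 : ℕ) : ℝ)) (by push_cast; linarith)).const_mul C
  have hN0 : ∀ x, 0 ≤ N x := fun x => (norm_nonneg x).trans (hle x)
  have hc : Continuous fun x => ω (N x) := ω.continuousOn.comp_continuous hN hN0
  refine hi.mono' (Real.continuous_exp.comp hc.neg).aestronglyMeasurable (ae_of_all _ fun x => ?_)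
  rw [Real.norm_of_nonneg (Real.exp_pos _).le, Real.rpow_neg (by positivity), Real.rpow_natCast,
    Real.exp_neg, ← div_eq_mul_inv, inv_eq_one_div, div_le_div_iff₀ (Real.exp_pos _) (by positivity),
    one_mul]
  refine le_trans ?_ (h (N x) (hN0 x))
  gcongr
  exact hle x

lemma integrable_exp_neg_norm (ω : Weight) :
    Integrable (fun x : Euc d => Real.exp (-ω ‖x‖)) :=
  ω.integrable_exp_neg_of_le volume _ continuous_norm fun _ => le_rfl

end Weight

/-! ### The Euclidean norm on phase space and the weight along it -/

lemma phaseNorm_eq (z : Euc d × Euc d) : phaseNorm z = ‖WithLp.toLp 2 z‖ := by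
  rw [WithLp.prod_norm_eq_of_L2]; rfl

lemma phaseNorm_nonneg (z : Euc d × Euc d) : 0 ≤ phaseNorm z := Real.sqrt_nonneg _

lemma phaseNorm_add_le (z w : Euc d × Euc d) : phaseNorm (z + w) ≤ phaseNorm z + phaseNorm w := by
  simp only [phaseNorm_eq, WithLp.toLp_add]
  exact norm_add_le _ _

lemma phaseNorm_neg (z : Euc d × Euc d) : phaseNorm (-z) = phaseNorm z := by
  simp [phaseNorm]

lemma phaseNorm_smul (t : ℝ) (z : Euc d × Euc d) : phaseNorm (t • z) = |t| * phaseNorm z := by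
  simp only [phaseNorm_eq, WithLp.toLp_smul, norm_smul, Real.norm_eq_abs]

lemma continuous_phaseNorm : Continuous (phaseNorm : Euc d × Euc d → ℝ) := by
  unfold phaseNorm; fun_prop

lemma norm_fst_le_phaseNorm (z : Euc d × Euc d) : ‖z.1‖ ≤ phaseNorm z :=
  Real.le_sqrt_of_sq_le (by nlinarith [sq_nonneg ‖z.2‖])

lemma norm_snd_le_phaseNorm (z : Euc d × Euc d) : ‖z.2‖ ≤ phaseNorm z :=
  Real.le_sqrt_of_sq_le (by nlinarith [sq_nonneg ‖z.1‖])

lemma norm_le_phaseNorm (z : Euc d × Euc d) : ‖z‖ ≤ phaseNorm z :=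
  max_le (norm_fst_le_phaseNorm z) (norm_snd_le_phaseNorm z)

lemma phaseNorm_le_add (z : Euc d × Euc d) : phaseNorm z ≤ ‖z.1‖ + ‖z.2‖ :=
  Real.sqrt_le_iff.2 ⟨by positivity, by nlinarith [norm_nonneg z.1, norm_nonneg z.2]⟩

lemma phaseNorm_pos {z : Euc d × Euc d} (hz : z ≠ 0) : 0 < phaseNorm z :=
  (norm_pos_iff.2 hz).trans_le (norm_le_phaseNorm z)

instance : (volume : Measure (Euc d × Euc d)).IsAddHaarMeasure :=
  inferInstanceAs ((volume : Measure (Euc d)).prod (volume : Measure (Euc d))).IsAddHaarMeasure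

namespace Weight

/-- The weight on phase space, `z ↦ ω(|z|)`. -/
def phase (ω : Weight) (z : Euc d × Euc d) : ℝ := ω (phaseNorm z)

lemma phase_nonneg (ω : Weight) (z : Euc d × Euc d) : 0 ≤ ω.phase z :=
  ω.nonneg _ (phaseNorm_nonneg z)

lemma phase_add_le (ω : Weight) (z w : Euc d × Euc d) :
    ω.phase (z + w) ≤ ω.phase z + ω.phase w :=
  (ω.monotoneOn (phaseNorm_nonneg _) (add_nonneg (phaseNorm_nonneg z) (phaseNorm_nonneg w))
    (phaseNorm_add_le z w)).trans (ω.subadd _ _ (phaseNorm_nonneg _) (phaseNorm_nonneg _))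

lemma phase_neg (ω : Weight) (z : Euc d × Euc d) : ω.phase (-z) = ω.phase z := by
  rw [phase, phaseNorm_neg, phase]

lemma phase_le_add_sub (ω : Weight) (z w : Euc d × Euc d) :
    ω.phase z ≤ ω.phase w + ω.phase (z - w) := by
  simpa using ω.phase_add_le w (z - w)

lemma phase_le_add (ω : Weight) (z : Euc d × Euc d) : ω.phase z ≤ ω ‖z.1‖ + ω ‖z.2‖ :=
  (ω.monotoneOn (phaseNorm_nonneg _) (add_nonneg (norm_nonneg z.1) (norm_nonneg z.2))
    (phaseNorm_le_add z)).trans (ω.subadd _ _ (norm_nonneg _) (norm_nonneg _))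

lemma apply_norm_fst_le_phase (ω : Weight) (z : Euc d × Euc d) : ω ‖z.1‖ ≤ ω.phase z :=
  ω.monotoneOn (norm_nonneg _) (phaseNorm_nonneg _) (norm_fst_le_phaseNorm z)

lemma apply_norm_snd_le_phase (ω : Weight) (z : Euc d × Euc d) : ω ‖z.2‖ ≤ ω.phase z :=
  ω.monotoneOn (norm_nonneg _) (phaseNorm_nonneg _) (norm_snd_le_phaseNorm z)

lemma continuous_phase (ω : Weight) : Continuous (ω.phase : Euc d × Euc d → ℝ) :=
  ω.continuousOn.comp_continuous continuous_phaseNorm phaseNorm_nonneg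

lemma integrable_exp_neg_phase (ω : Weight) :
    Integrable (fun z : Euc d × Euc d => Real.exp (-ω.phase z)) :=
  ω.integrable_exp_neg_of_le volume _ continuous_phaseNorm norm_le_phaseNorm

/-- Iterated subadditivity. The term `ω 0` is what the case `n = 0` needs, as `ω 0 = 0` is not
assumed. -/
lemma apply_nsmul_le (ω : Weight) (n : ℕ) {t : ℝ} (ht : 0 ≤ t) : ω (n * t) ≤ ω 0 + n * ω t := by
  induction n with
  | zero => simp
  | succ n ih =>
    have := ω.subadd (n * t) t (by positivity) ht
    push_cast
    rw [add_mul, one_mul]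
    linarith

end Weight

/-! ### Phase-space shifts of rapidly decaying functions -/

lemma contDiff_shiftFun_uncurry {h : Euc d → ℂ} {n : WithTop ℕ∞} (ch : ContDiff ℝ n h) :
    ContDiff ℝ n fun p : (Euc d × Euc d) × Euc d => shiftFun p.1 h p.2 := by
  unfold shiftFun character
  refine ContDiff.mul (ContDiff.cexp (contDiff_const.mul
    (Complex.ofRealCLM.contDiff.comp (contDiff_snd.inner ℝ (contDiff_snd.comp contDiff_fst)))))
    (ch.comp (contDiff_snd.sub (contDiff_fst.comp contDiff_fst)))

lemma contDiff_shiftFun {h : Euc d → ℂ} {n : WithTop ℕ∞} (ch : ContDiff ℝ n h)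
    (z : Euc d × Euc d) : ContDiff ℝ n (shiftFun z h) :=
  (contDiff_character z.2 n).mul (ch.comp (contDiff_id.sub contDiff_const))

/-- Each derivative in the second variable spends one order of joint smoothness, so the induction
runs with `m` general. -/
lemma contDiff_iteratedFDeriv_uncurry {Z E F : Type*} [NormedAddCommGroup Z] [NormedSpace ℝ Z]
    [NormedAddCommGroup E] [NormedSpace ℝ E] [NormedAddCommGroup F] [NormedSpace ℝ F]
    {f : Z → E → F} (n : ℕ) (m : ℕ) (hf : ContDiff ℝ (m + n : ℕ) fun p : Z × E => f p.1 p.2) :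
    ContDiff ℝ m fun p : Z × E => iteratedFDeriv ℝ n (f p.1) p.2 := by
  induction n generalizing m with
  | zero =>
    simp only [iteratedFDeriv_zero_eq_comp]
    exact (LinearIsometryEquiv.contDiff _).comp hf
  | succ n ih =>
    simp only [iteratedFDeriv_succ_eq_comp_left]
    have h1 : ContDiff ℝ (m + 1 : ℕ) fun p : Z × E => iteratedFDeriv ℝ n (f p.1) p.2 :=
      ih (m + 1) (by rwa [show m + 1 + n = m + (n + 1) by ring])
    have h2 : ContDiff ℝ m fun p : Z × E => fderiv ℝ (iteratedFDeriv ℝ n (f p.1)) p.2 :=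
      ContDiff.fderiv (m := (m + 1 : ℕ)) (f := fun (p : Z × E) (y : E) =>
        iteratedFDeriv ℝ n (f p.1) y)
        (h1.comp ((contDiff_fst.comp contDiff_fst).prodMk contDiff_snd)) contDiff_snd (by norm_cast)
    exact h2.continuousLinearMap_comp
      ((continuousMultilinearCurryLeftEquiv ℝ (fun _ : Fin (n + 1) => E) F).symm :
        _ →L[ℝ] ContinuousMultilinearMap ℝ (fun _ : Fin (n + 1) => E) F)

lemma continuous_iteratedFDeriv_shiftFun {h : Euc d → ℂ} (ch : ∀ n : ℕ, ContDiff ℝ n h) (n : ℕ)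
    {X : Type*} [TopologicalSpace X] {P : X → Euc d × Euc d} (hP : Continuous P) {Q : X → Euc d}
    (hQ : Continuous Q) :
    Continuous fun p => iteratedFDeriv ℝ n (shiftFun (P p) h) (Q p) := by
  have h1 : Continuous fun p : (Euc d × Euc d) × Euc d => iteratedFDeriv ℝ n (shiftFun p.1 h) p.2 :=
    (contDiff_iteratedFDeriv_uncurry (f := fun z => shiftFun z h) n 0
      (contDiff_shiftFun_uncurry (ch _))).continuous
  have h2 := h1.comp (hP.prodMk hQ)
  exact h2

/-- In the Leibniz formula, derivatives of the character give powers of `|ξ|`, absorbed by one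
factor `e^{ω(ξ)}`, while the translation costs `e^{lω(x)}` by subadditivity. Together this is the
exponent `l + 1`. -/
lemma exists_iteratedFDeriv_shiftFun_le {h : Euc d → ℂ} (hh : RapidDecay ω h)
    (ch : ∀ n : ℕ, ContDiff ℝ n h) {l : ℝ} (hl : 0 < l) (n : ℕ) :
    ∃ C : ℝ, 0 < C ∧ ∀ z y, Real.exp (l * ω ‖y‖) * ‖iteratedFDeriv ℝ n (shiftFun z h) y‖ ≤
      C * Real.exp ((l + 1) * ω.phase z) := by
  choose A hA using fun k => hh l hl k
  obtain ⟨P, hP, hPle⟩ := ω.exists_one_add_pow_le n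
  have hA' : ∀ k y, Real.exp (l * ω ‖y‖) * ‖iteratedFDeriv ℝ k h y‖ ≤ |A k| := fun k y =>
    (hA k ⟨y, rfl⟩).trans (le_abs_self _)
  refine ⟨P * (∑ i ∈ Finset.range (n + 1), (n.choose i : ℝ) * |A (n - i)| + 1), by positivity,
    fun z y => ?_⟩
  have c2 : ContDiff ℝ n fun y => h (y - z.1) := (ch n).comp (contDiff_id.sub contDiff_const)
  have e1 : Real.exp (l * ω ‖y‖) ≤ Real.exp (l * ω ‖z.1‖) * Real.exp (l * ω ‖y - z.1‖) := by
    rw [← Real.exp_add, ← mul_add]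
    gcongr
    exact ω.apply_norm_le_add_sub y z.1
  have e2 : Real.exp (l * ω ‖z.1‖) * Real.exp (ω ‖z.2‖) ≤ Real.exp ((l + 1) * ω.phase z) := by
    rw [← Real.exp_add, add_mul, one_mul]
    gcongr
    · exact ω.apply_norm_fst_le_phase z
    · exact ω.apply_norm_snd_le_phase z
  calc _ ≤ Real.exp (l * ω ‖y‖) * ∑ i ∈ Finset.range (n + 1), (n.choose i : ℝ) *
          ‖iteratedFDeriv ℝ i (character z.2) y‖ *
            ‖iteratedFDeriv ℝ (n - i) (fun y => h (y - z.1)) y‖ := by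
        gcongr
        exact norm_iteratedFDeriv_mul_le (contDiff_character z.2 n) c2 y le_rfl
    _ ≤ ∑ i ∈ Finset.range (n + 1), (Real.exp (l * ω ‖z.1‖) * (1 + ‖z.2‖) ^ n) *
          ((n.choose i : ℝ) * |A (n - i)|) := by
        rw [Finset.mul_sum]
        refine Finset.sum_le_sum fun i hi => ?_
        rw [iteratedFDeriv_comp_sub]
        have h2 : ‖iteratedFDeriv ℝ i (character z.2) y‖ ≤ (1 + ‖z.2‖) ^ n :=
          (norm_iteratedFDeriv_character_le z.2 i y).trans <| by
            calc ‖z.2‖ ^ i ≤ (1 + ‖z.2‖) ^ i := by gcongr; linarith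
              _ ≤ _ := pow_le_pow_right₀ (by linarith [norm_nonneg z.2])
                (Finset.mem_range_succ_iff.1 hi)
        have h3 := hA' (n - i) (y - z.1)
        calc _ ≤ Real.exp (l * ω ‖z.1‖) * Real.exp (l * ω ‖y - z.1‖) * ((n.choose i : ℝ) *
              (1 + ‖z.2‖) ^ n * ‖iteratedFDeriv ℝ (n - i) h (y - z.1)‖) := by gcongr
          _ = Real.exp (l * ω ‖z.1‖) * (1 + ‖z.2‖) ^ n * ((n.choose i : ℝ) *
              (Real.exp (l * ω ‖y - z.1‖) * ‖iteratedFDeriv ℝ (n - i) h (y - z.1)‖)) := by ring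
          _ ≤ _ := by gcongr
    _ ≤ (Real.exp (l * ω ‖z.1‖) * (P * Real.exp (ω ‖z.2‖))) *
          (∑ i ∈ Finset.range (n + 1), (n.choose i : ℝ) * |A (n - i)| + 1) := by
        rw [← Finset.mul_sum]
        gcongr
        · exact hPle _ (norm_nonneg _)
        · linarith
    _ = P * (∑ i ∈ Finset.range (n + 1), (n.choose i : ℝ) * |A (n - i)| + 1) *
          (Real.exp (l * ω ‖z.1‖) * Real.exp (ω ‖z.2‖)) := by ring
    _ ≤ _ := by gcongr

/-! ### The components of `𝒮_ω` in spaces of bounded continuous functions -/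

/-- A jointly continuous family of bounded functions with locally uniform decay at infinity is
continuous for the supremum norm. -/
lemma continuous_boundedContinuousFunction_of_decay {Z Y V : Type*} [TopologicalSpace Z]
    [TopologicalSpace Y] [NormedAddCommGroup V] (F : Z → BoundedContinuousFunction Y V)
    (hF : Continuous fun p : Z × Y => F p.1 p.2) (B : Z → ℝ) (hB : Continuous B) (g : Y → ℝ)
    (hg : Tendsto g (cocompact Y) (𝓝 0)) (hg0 : ∀ y, 0 ≤ g y)
    (hle : ∀ z y, ‖F z y‖ ≤ B z * g y) : Continuous F := by
  rw [continuous_iff_continuousAt]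
  intro z₀
  rw [ContinuousAt, Metric.tendsto_nhds]
  intro ε hε
  -- `M` bounds `B` near `z₀`. Off a suitable compact set the decay makes both functions at most `ε
  -- / 4`; on it, joint continuity gives uniform closeness.
  set M := |B z₀| + 1
  have hM : 0 < M := by positivity
  have hU : ∀ᶠ z in 𝓝 z₀, B z < M :=
    hB.continuousAt.eventually (gt_mem_nhds ((le_abs_self _).trans_lt (lt_add_one _)))
  obtain ⟨K, hK, hKg⟩ : ∃ K, IsCompact K ∧ ∀ y ∉ K, g y < ε / (4 * M) := by
    have := hg.eventually (gt_mem_nhds (show 0 < ε / (4 * M) by positivity))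
    obtain ⟨K, hK, h⟩ := mem_cocompact.1 this
    exact ⟨K, hK, fun y hy => h hy⟩
  have hcurry : Continuous fun z => (F z).toContinuousMap :=
    ContinuousMap.continuous_of_continuous_uncurry _ hF
  have hunif := (ContinuousMap.tendsto_iff_forall_isCompact_tendstoUniformlyOn.1
    (hcurry.tendsto z₀)) K hK
  rw [Metric.tendstoUniformlyOn_iff] at hunif
  filter_upwards [hU, hunif (ε / 2) (half_pos hε)] with z hz hzK
  refine (((F z).dist_le (half_pos hε).le).2 fun y => ?_).trans_lt (half_lt_self hε)
  by_cases hy : y ∈ K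
  · rw [dist_comm]
    exact (hzK y hy).le
  · have key : ∀ w, B w < M → ‖F w y‖ ≤ ε / 4 := fun w hw =>
      calc ‖F w y‖ ≤ B w * g y := hle w y
        _ ≤ M * g y := mul_le_mul_of_nonneg_right hw.le (hg0 y)
        _ ≤ M * (ε / (4 * M)) := by gcongr; exact (hKg y hy).le
        _ = ε / 4 := by field_simp
    calc dist (F z y) (F z₀ y) ≤ ‖F z y‖ + ‖F z₀ y‖ := by
          rw [dist_eq_norm]; exact norm_sub_le _ _
      _ ≤ ε / 4 + ε / 4 := add_le_add (key z hz) (key z₀ hU.self_of_nhds)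
      _ = ε / 2 := by ring

/-- Since `log t = o(ω(t))`, the weight tends to infinity. -/
lemma Weight.tendsto_exp_neg_norm (ω : Weight) :
    Tendsto (fun x : Euc d => Real.exp (-ω ‖x‖)) (cocompact _) (𝓝 0) := by
  refine Real.tendsto_exp_neg_atTop_nhds_zero.comp ?_
  refine Tendsto.comp ?_ (tendsto_norm_cocompact_atTop (E := Euc d))
  have h := ω.log_isLittleO.def one_pos
  refine tendsto_atTop_mono' _ ?_ Real.tendsto_log_atTop
  filter_upwards [h, eventually_ge_atTop 0] with t ht ht0
  rw [one_mul, Real.norm_of_nonneg (ω.nonneg t ht0)] at ht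
  exact (le_abs_self _).trans ht

/-- The index set of the defining seminorms of `𝒮_ω`. -/
abbrev SemiIdx : Type := (Ioi (0 : ℝ) × ℕ) ⊕ (Ioi (0 : ℝ) × ℕ)

/-- The weight exponent of a seminorm. -/
def SemiIdx.expo (i : SemiIdx) : ℝ := Sum.elim (fun j => (j.1 : ℝ)) (fun j => (j.1 : ℝ)) i

/-- The order of differentiation of a seminorm. -/
def SemiIdx.order (i : SemiIdx) : ℕ := Sum.elim (fun j => j.2) (fun j => j.2) i

lemma SemiIdx.expo_pos (i : SemiIdx) : 0 < i.expo := by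
  rcases i with i | i <;> exact i.1.2

/-- The function, `f` or its Fourier transform, that a seminorm evaluates. -/
def SemiIdx.side (i : SemiIdx) (f : Euc d → ℂ) : Euc d → ℂ :=
  Sum.elim (fun _ => f) (fun _ => angFourier f) i

namespace SOmega

lemma side_rapidDecay (i : SemiIdx) (f : SOmega ω d) : RapidDecay ω (i.side f) := by
  rcases i with i | i
  · exact f.decay
  · exact f.decay_fourier

lemma side_contDiff (i : SemiIdx) (f : SOmega ω d) (n : ℕ) : ContDiff ℝ n (i.side f) := by
  rcases i with i | i
  · exact f.toSchwartz.smooth n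
  · exact contDiff_angFourier f.toSchwartz n

lemma side_add (i : SemiIdx) (f g : SOmega ω d) : i.side (f + g) = i.side f + i.side g := by
  rcases i with i | i
  · rfl
  · exact angFourier_add f.toSchwartz g.toSchwartz

lemma side_smul (i : SemiIdx) (c : ℂ) (f : SOmega ω d) : i.side (c • f) = c • i.side f := by
  rcases i with i | i
  · rfl
  · exact angFourier_smul c f.toSchwartz

lemma seminormFamily_apply (i : SemiIdx) (f : SOmega ω d) :
    seminormFamily ω d i f =
      ⨆ x, Real.exp (i.expo * ω ‖x‖) * ‖iteratedFDeriv ℝ i.order (i.side f) x‖ := by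
  rcases i with i | i <;> rfl

lemma le_seminormFamily (i : SemiIdx) (f : SOmega ω d) (x : Euc d) :
    Real.exp (i.expo * ω ‖x‖) * ‖iteratedFDeriv ℝ i.order (i.side f) x‖ ≤
      seminormFamily ω d i f := by
  rw [seminormFamily_apply]
  exact le_ciSup (f.side_rapidDecay i _ i.expo_pos i.order) x

lemma seminormFamily_le {i : SemiIdx} {f : SOmega ω d} {B : ℝ}
    (h : ∀ x, Real.exp (i.expo * ω ‖x‖) * ‖iteratedFDeriv ℝ i.order (i.side f) x‖ ≤ B) :
    seminormFamily ω d i f ≤ B := by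
  rw [seminormFamily_apply]
  exact ciSup_le h

/-- The bounded continuous function `x ↦ e^{lω(x)} D^n f(x)` or `x ↦ e^{lω(x)} D^n f̂(x)`
underlying the seminorm with index `i`. -/
def component (i : SemiIdx) :
    SOmega ω d →ₗ[ℂ] BoundedContinuousFunction (Euc d)
      (ContinuousMultilinearMap ℝ (fun _ : Fin i.order => Euc d) ℂ) where
  toFun f := BoundedContinuousFunction.ofNormedAddCommGroup
    (fun x => Real.exp (i.expo * ω ‖x‖) • iteratedFDeriv ℝ i.order (i.side f) x)
    ((ω.continuous_exp_mul_norm _).smul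
      ((f.side_contDiff i _).continuous_iteratedFDeriv le_rfl))
    (seminormFamily ω d i f)
    (fun x => by
      rw [norm_smul, Real.norm_of_nonneg (Real.exp_pos _).le]
      exact f.le_seminormFamily i x)
  map_add' f g := by
    ext1 x
    change Real.exp (i.expo * ω ‖x‖) • iteratedFDeriv ℝ i.order (i.side (f + g)) x = _
    rw [side_add, iteratedFDeriv_add_apply (f.side_contDiff i _).contDiffAt
      (g.side_contDiff i _).contDiffAt, smul_add]
    rfl
  map_smul' c f := by
    ext1 x
    change Real.exp (i.expo * ω ‖x‖) • iteratedFDeriv ℝ i.order (i.side (c • f)) x = _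
    rw [side_smul, iteratedFDeriv_const_smul_apply (f.side_contDiff i _).contDiffAt,
      smul_comm]
    rfl

lemma component_apply (i : SemiIdx) (f : SOmega ω d) (x : Euc d) :
    component i f x = Real.exp (i.expo * ω ‖x‖) • iteratedFDeriv ℝ i.order (i.side f) x := rfl

lemma seminormFamily_le_norm_component (i : SemiIdx) (f : SOmega ω d) :
    seminormFamily ω d i f ≤ ‖component i f‖ := by
  refine seminormFamily_le fun x => ?_
  refine le_trans (le_of_eq ?_) ((component i f).norm_coe_le_norm x)
  rw [component_apply, norm_smul, Real.norm_of_nonneg (Real.exp_pos _).le]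

/-- The phase-space shift that acts on the given side. -/
def _root_.GaborWF.SemiIdx.point (i : SemiIdx) (z : Euc d × Euc d) : Euc d × Euc d :=
  Sum.elim (fun _ => z) (fun _ => (z.2, -z.1)) i

/-- The phase factor that appears on the given side. -/
def _root_.GaborWF.SemiIdx.factor (i : SemiIdx) (z : Euc d × Euc d) : ℂ :=
  Sum.elim (fun _ => 1) (fun _ => Complex.exp (Complex.I * (inner ℝ z.1 z.2 : ℝ))) i

lemma coe_shift (z : Euc d × Euc d) (f : SOmega ω d) :
    (f.shift z : Euc d → ℂ) = shiftFun z f := funext fun y => shift_apply z f y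

/-- The Fourier transform turns the shift by `(x, ξ)` into the shift by `(ξ, -x)` up to a unimodular
factor. Space and frequency seminorms can therefore be treated by the same estimates. -/
lemma side_shift (i : SemiIdx) (z : Euc d × Euc d) (f : SOmega ω d) :
    i.side (f.shift z) = i.factor z • shiftFun (i.point z) (i.side f) := by
  rcases i with i | i
  · change ⇑(f.shift z).toSchwartz = (1 : ℂ) • shiftFun z f
    rw [one_smul, coe_shift]
  · change angFourier ⇑(f.shift z).toSchwartz = _
    rw [coe_shift]
    exact funext (angFourier_shiftFun z f)

lemma norm_factor (i : SemiIdx) (z : Euc d × Euc d) : ‖i.factor z‖ = 1 := by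
  rcases i with i | i
  · exact norm_one
  · simp [SemiIdx.factor, Complex.norm_exp]

lemma continuous_factor (i : SemiIdx) : Continuous (i.factor : Euc d × Euc d → ℂ) := by
  rcases i with i | i
  · exact continuous_const
  · change Continuous fun z : Euc d × Euc d => Complex.exp (Complex.I * (inner ℝ z.1 z.2 : ℝ))
    fun_prop

lemma continuous_point (i : SemiIdx) :
    Continuous (i.point : Euc d × Euc d → Euc d × Euc d) := by
  rcases i with i | i
  · exact continuous_id
  · exact continuous_snd.prodMk continuous_fst.neg

lemma phase_point (i : SemiIdx) (z : Euc d × Euc d) : ω.phase (i.point z) = ω.phase z := by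
  rcases i with i | i
  · rfl
  · simp only [Weight.phase, phaseNorm, SemiIdx.point, Sum.elim_inr, norm_neg, add_comm]

lemma exists_iteratedFDeriv_side_shift_le (i : SemiIdx) (f : SOmega ω d) {l : ℝ} (hl : 0 < l)
    (n : ℕ) : ∃ C : ℝ, 0 < C ∧ ∀ z y,
      Real.exp (l * ω ‖y‖) * ‖iteratedFDeriv ℝ n (i.side (f.shift z)) y‖ ≤
        C * Real.exp ((l + 1) * ω.phase z) := by
  obtain ⟨C, hC, h⟩ := exists_iteratedFDeriv_shiftFun_le (f.side_rapidDecay i)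
    (f.side_contDiff i) hl n
  refine ⟨C, hC, fun z y => ?_⟩
  have c : ContDiff ℝ n (shiftFun (i.point z) (i.side f)) :=
    contDiff_shiftFun (f.side_contDiff i n) _
  rw [side_shift, iteratedFDeriv_const_smul_apply c.contDiffAt, norm_smul, norm_factor, one_mul,
    ← phase_point i z]
  exact h _ y

lemma continuous_iteratedFDeriv_side_shift (i : SemiIdx) (f : SOmega ω d) (n : ℕ) :
    Continuous fun p : (Euc d × Euc d) × Euc d =>
      iteratedFDeriv ℝ n (i.side (f.shift p.1)) p.2 := by
  have hc : ∀ p : (Euc d × Euc d) × Euc d, iteratedFDeriv ℝ n (i.side (f.shift p.1)) p.2 =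
      i.factor p.1 • iteratedFDeriv ℝ n (shiftFun (i.point p.1) (i.side f)) p.2 := by
    intro p
    have c : ContDiff ℝ n (shiftFun (i.point p.1) (i.side f)) :=
      contDiff_shiftFun (f.side_contDiff i _) _
    rw [side_shift, iteratedFDeriv_const_smul_apply c.contDiffAt]
  have h1 : Continuous fun p : (Euc d × Euc d) × Euc d =>
      iteratedFDeriv ℝ n (shiftFun (i.point p.1) (i.side f)) p.2 :=
    continuous_iteratedFDeriv_shiftFun (f.side_contDiff i) n
      ((continuous_point i).comp continuous_fst) continuous_snd
  have h2 : Continuous fun p : (Euc d × Euc d) × Euc d => (i.factor p.1 : ℂ) :=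
    (continuous_factor i).comp continuous_fst
  exact (h2.smul h1).congr fun p => (hc p).symm

/-- The shifts of a fixed function depend continuously on the phase-space point. -/
lemma continuous_component_shift (i : SemiIdx) (f : SOmega ω d) :
    Continuous fun z => component i (f.shift z) := by
  -- One unit of weight more than the seminorm requires leaves a factor `e^{-ω(y)}`, the decay at
  -- infinity needed for continuity in the supremum norm.
  obtain ⟨C, hC, h⟩ := f.exists_iteratedFDeriv_side_shift_le i (l := i.expo + 1)
    (by linarith [i.expo_pos]) i.order
  refine continuous_boundedContinuousFunction_of_decay _ ?_
    (fun z => C * Real.exp ((i.expo + 1 + 1) * ω.phase z)) ?_ _ (ω.tendsto_exp_neg_norm)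
    (fun y => (Real.exp_pos _).le) ?_
  · have h3 : Continuous fun p : (Euc d × Euc d) × Euc d => Real.exp (i.expo * ω ‖p.2‖) :=
      (ω.continuous_exp_mul_norm _).comp continuous_snd
    exact h3.smul (f.continuous_iteratedFDeriv_side_shift i i.order)
  · exact continuous_const.mul (Real.continuous_exp.comp
      (continuous_const.mul ω.continuous_phase))
  · intro z y
    rw [component_apply, norm_smul, Real.norm_of_nonneg (Real.exp_pos _).le]
    calc _ = (Real.exp ((i.expo + 1) * ω ‖y‖) *
          ‖iteratedFDeriv ℝ i.order (i.side (f.shift z)) y‖) * Real.exp (-ω ‖y‖) := by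
          rw [mul_right_comm, ← Real.exp_add]; ring_nf
      _ ≤ _ := by exact mul_le_mul_of_nonneg_right (h z y) (Real.exp_pos _).le

lemma exists_norm_component_shift_le (i : SemiIdx) (f : SOmega ω d) :
    ∃ C : ℝ, 0 < C ∧ ∀ z,
      ‖component i (f.shift z)‖ ≤ C * Real.exp ((i.expo + 1) * ω.phase z) := by
  obtain ⟨C, hC, h⟩ := f.exists_iteratedFDeriv_side_shift_le i i.expo_pos i.order
  refine ⟨C, hC, fun z => (BoundedContinuousFunction.norm_le (by positivity)).2 fun y => ?_⟩
  rw [component_apply, norm_smul, Real.norm_of_nonneg (Real.exp_pos _).le]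
  exact h z y

end SOmega

/-! ### Functionals on `𝒮_ω` and growth of the short-time Fourier transform -/

namespace SOmega

lemma ext {f g : SOmega ω d} (h : ∀ y, f y = g y) : f = g :=
  Subtype.ext (SchwartzMap.ext h)

/-- The product of the spaces of bounded continuous functions containing the components with
indices in a finite set. -/
def CompSpace (d : ℕ) (s : Finset SemiIdx) : Type :=
  ∀ i : s, BoundedContinuousFunction (Euc d)
    (ContinuousMultilinearMap ℝ (fun _ : Fin i.1.order => Euc d) ℂ)

instance (s : Finset SemiIdx) : NormedAddCommGroup (CompSpace d s) :=
  inferInstanceAs (NormedAddCommGroup (∀ i : s, BoundedContinuousFunction (Euc d)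
    (ContinuousMultilinearMap ℝ (fun _ : Fin i.1.order => Euc d) ℂ)))

instance (s : Finset SemiIdx) : NormedSpace ℂ (CompSpace d s) :=
  inferInstanceAs (NormedSpace ℂ (∀ i : s, BoundedContinuousFunction (Euc d)
    (ContinuousMultilinearMap ℝ (fun _ : Fin i.1.order => Euc d) ℂ)))

instance (s : Finset SemiIdx) : CompleteSpace (CompSpace d s) :=
  inferInstanceAs (CompleteSpace (∀ i : s, BoundedContinuousFunction (Euc d)
    (ContinuousMultilinearMap ℝ (fun _ : Fin i.1.order => Euc d) ℂ)))

/-- The coordinate projections of `CompSpace`. -/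
def CompSpace.proj {s : Finset SemiIdx} (i : s) :
    CompSpace d s →L[ℂ] BoundedContinuousFunction (Euc d)
      (ContinuousMultilinearMap ℝ (fun _ : Fin i.1.order => Euc d) ℂ) :=
  ContinuousLinearMap.proj (R := ℂ) (φ := fun i : s => BoundedContinuousFunction (Euc d)
    (ContinuousMultilinearMap ℝ (fun _ : Fin i.1.order => Euc d) ℂ)) i

/-- Finitely many components of an element of `𝒮_ω`. -/
def components (s : Finset SemiIdx) : SOmega ω d →ₗ[ℂ] CompSpace d s :=
  LinearMap.pi fun i : s => component i.1

lemma continuous_components_shift (s : Finset SemiIdx) (f : SOmega ω d) :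
    Continuous fun z => components s (f.shift z) :=
  continuous_pi fun i => continuous_component_shift i.1 f

lemma exists_norm_components_shift_le (s : Finset SemiIdx) (f : SOmega ω d) :
    ∃ C μ : ℝ, 0 < C ∧ 0 < μ ∧ ∀ z,
      ‖components s (f.shift z)‖ ≤ C * Real.exp (μ * ω.phase z) := by
  choose C hC h using fun i : s => exists_norm_component_shift_le i.1 f
  have hexpo : ∀ i : s, 0 < i.1.expo := fun i => i.1.expo_pos
  refine ⟨∑ i, C i + 1, ∑ i : s, i.1.expo + 1, ?_, ?_, fun z => ?_⟩
  · have := Finset.sum_nonneg fun i (_ : i ∈ Finset.univ) => (hC i).le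
    linarith
  · have := Finset.sum_nonneg fun i (_ : i ∈ (Finset.univ : Finset s)) => (hexpo i).le
    linarith
  · have h0 := Finset.sum_nonneg fun i (_ : i ∈ Finset.univ) => (hC i).le
    refine (pi_norm_le_iff_of_nonneg (by positivity)).2 fun i => (h i z).trans ?_
    have h1 : C i ≤ ∑ i, C i + 1 :=
      (Finset.single_le_sum (fun i _ => (hC i).le) (Finset.mem_univ i)).trans (by linarith)
    have h2 : i.1.expo ≤ ∑ i : s, i.1.expo :=
      Finset.single_le_sum (f := fun i : s => i.1.expo) (fun i _ => (hexpo i).le)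
        (Finset.mem_univ i)
    have h3 := ω.phase_nonneg z
    gcongr

/-- The component of order zero is `f` times a positive weight, so it alone determines `f`. -/
lemma components_injective {s : Finset SemiIdx}
    (hs : Sum.inl (⟨1, zero_lt_one' ℝ⟩, 0) ∈ s) :
    Function.Injective (components s : SOmega ω d → CompSpace d s) := by
  rw [injective_iff_map_eq_zero]
  intro f hf
  refine ext fun y => ?_
  have h1 : component (Sum.inl (⟨1, zero_lt_one' ℝ⟩, 0)) f = 0 := congrFun hf ⟨_, hs⟩
  have h2 : Real.exp (1 * ω ‖y‖) • iteratedFDeriv ℝ 0 (f : Euc d → ℂ) y = 0 :=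
    congrArg (fun F => F y) h1
  have h3 := norm_eq_zero.2 ((smul_eq_zero.1 h2).resolve_left (Real.exp_pos _).ne')
  rw [norm_iteratedFDeriv_zero, norm_eq_zero] at h3
  exact h3

/-- Every `ω`-tempered distribution factors through finitely many components. -/
lemma exists_extension (u : DOmega ω d) :
    ∃ (s : Finset SemiIdx) (U : CompSpace d s →L[ℂ] ℂ), ∀ f, u f = U (components s f) := by
  classical
  obtain ⟨s₀, C, -, hC⟩ := Seminorm.bound_of_continuous (withSeminorms (ω := ω) (d := d))
    ((normSeminorm ℂ ℂ).comp u.toLinearMap) (continuous_norm.comp u.continuous)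
  -- The extra index makes `components s` injective. The functional can then be transported to the
  -- range of `components s` and extended by Hahn–Banach.
  set s := insert (Sum.inl (⟨1, zero_lt_one' ℝ⟩, 0)) s₀
  have hle : ∀ f : SOmega ω d, ‖u f‖ ≤ C * ‖components s f‖ := by
    intro f
    refine (hC f).trans ?_
    change (C : ℝ) * (s₀.sup (seminormFamily ω d)) f ≤ _
    gcongr
    refine Seminorm.finset_sup_apply_le (norm_nonneg _) fun i hi => ?_
    exact (seminormFamily_le_norm_component i f).trans
      (norm_le_pi_norm (components s f) ⟨i, Finset.mem_insert_of_mem hi⟩)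
  have hinj : Function.Injective (components s : SOmega ω d → CompSpace d s) :=
    components_injective (Finset.mem_insert_self _ _)
  set e := LinearEquiv.ofInjective (components (ω := ω) s) hinj
  set u₀ : (components (ω := ω) (d := d) s).range →L[ℂ] ℂ :=
    (u.toLinearMap ∘ₗ e.symm.toLinearMap).mkContinuous C (by
      intro w
      obtain ⟨f, rfl⟩ := e.surjective w
      change ‖u (e.symm (e f))‖ ≤ _
      rw [e.symm_apply_apply]
      exact hle f)
  obtain ⟨U, hU, -⟩ := exists_extension_norm_eq _ u₀
  refine ⟨s, U, fun f => ?_⟩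
  have h := hU (e f)
  rw [show ((e f : (components (ω := ω) (d := d) s).range) : CompSpace d s) = components s f
    from rfl] at h
  rw [h]
  simp [u₀]

/-- The point `(x, -ξ)`. -/
def _root_.GaborWF.conjPoint (z : Euc d × Euc d) : Euc d × Euc d := (z.1, -z.2)

lemma conj_shift (f : SOmega ω d) (z : Euc d × Euc d) :
    (f.shift z).conj = f.conj.shift (conjPoint z) := by
  refine ext fun y => ?_
  rw [conj_apply, shift_apply, shift_apply, conj_apply, map_mul]
  congr 1
  rw [character, character, ← Complex.exp_conj]
  simp [conjPoint]

lemma conj_conj (f : SOmega ω d) : f.conj.conj = f :=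
  ext fun y => by simp [conj_apply]

end SOmega

lemma phase_conjPoint (z : Euc d × Euc d) : ω.phase (conjPoint z) = ω.phase z := by
  simp [Weight.phase, phaseNorm, conjPoint]

lemma continuous_conjPoint : Continuous (conjPoint : Euc d × Euc d → Euc d × Euc d) :=
  continuous_fst.prodMk continuous_snd.neg

/-- The conjugation hidden in `pairing` moves to the window and reflects the frequency, leaving a
plain value of the linear functional `u`. -/
lemma stft_eq (φ : SOmega ω d) (u : DOmega ω d) (z : Euc d × Euc d) :
    stft φ u z = u (φ.conj.shift (conjPoint z)) := by
  rw [stft, pairing, SOmega.conj_shift]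

lemma continuous_apply_shift (f : SOmega ω d) (u : DOmega ω d) :
    Continuous fun z => u (f.shift z) := by
  obtain ⟨s, U, hU⟩ := SOmega.exists_extension u
  simp only [hU]
  exact U.continuous.comp (SOmega.continuous_components_shift s f)

lemma continuous_stft (φ : SOmega ω d) (u : DOmega ω d) : Continuous (stft φ u) := by
  rw [show stft φ u = fun z => _ from funext (stft_eq φ u)]
  exact (continuous_apply_shift φ.conj u).comp continuous_conjPoint

lemma exists_norm_stft_le (φ : SOmega ω d) (u : DOmega ω d) :
    ∃ C μ : ℝ, 0 < C ∧ 0 < μ ∧ ∀ z, ‖stft φ u z‖ ≤ C * Real.exp (μ * ω.phase z) := by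
  obtain ⟨s, U, hU⟩ := SOmega.exists_extension u
  obtain ⟨C, μ, hC, hμ, h⟩ := SOmega.exists_norm_components_shift_le s φ.conj
  refine ⟨(‖U‖ + 1) * C, μ, by positivity, hμ, fun z => ?_⟩
  rw [stft_eq, hU, mul_assoc, ← phase_conjPoint]
  refine (U.le_opNorm _).trans ?_
  gcongr
  · linarith
  · exact h _

/-! ### Decay of the short-time Fourier transform of elements of `𝒮_ω` -/

lemma norm_shiftFun (z : Euc d × Euc d) (f : Euc d → ℂ) (y : Euc d) :
    ‖shiftFun z f y‖ = ‖f (y - z.1)‖ := by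
  simp [shiftFun, character, Complex.norm_exp]

/-- Subadditivity gives `e^{-lω(y)} e^{-lω(y-x)} ≤ e^{-lω(x)}`, and the additional unit in the
exponent for `k` leaves the integrable factor `e^{-ω(y-x)}`. Only the modulus of `k'` enters, so
modulated windows are covered on both the space and the frequency side. -/
lemma norm_integral_mul_conj_le {h k k' : Euc d → ℂ} {l P Q : ℝ} (hl : 0 ≤ l) (x : Euc d)
    (hP : ∀ y, Real.exp (l * ω ‖y‖) * ‖h y‖ ≤ P)
    (hQ : ∀ y, Real.exp ((l + 1) * ω ‖y‖) * ‖k y‖ ≤ Q) (hk : ∀ y, ‖k' y‖ = ‖k (y - x)‖) :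
    ‖∫ y, h y * starRingEnd ℂ (k' y)‖ ≤
      P * Q * (∫ y : Euc d, Real.exp (-ω ‖y‖)) * Real.exp (-(l * ω ‖x‖)) := by
  have hI : Integrable fun y : Euc d => P * Q * Real.exp (-(l * ω ‖x‖)) *
      Real.exp (-ω ‖y - x‖) := (ω.integrable_exp_neg_norm.comp_sub_right x).const_mul _
  have hP0 : 0 ≤ P := le_trans (by positivity) (hP 0)
  have h1 : ∀ y, ‖h y‖ ≤ P * Real.exp (-(l * ω ‖y‖)) := fun y => by
    rw [Real.exp_neg, ← div_eq_mul_inv, le_div_iff₀ (Real.exp_pos _), mul_comm]; exact hP y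
  have h2 : ∀ y, ‖k y‖ ≤ Q * Real.exp (-((l + 1) * ω ‖y‖)) := fun y => by
    rw [Real.exp_neg, ← div_eq_mul_inv, le_div_iff₀ (Real.exp_pos _), mul_comm]; exact hQ y
  have hQ0 : 0 ≤ Q := le_trans (by positivity) (hQ 0)
  refine (norm_integral_le_of_norm_le hI (ae_of_all _ fun y => ?_)).trans (le_of_eq ?_)
  · rw [norm_mul, RCLike.norm_conj, hk]
    calc _ ≤ (P * Real.exp (-(l * ω ‖y‖))) * (Q * Real.exp (-((l + 1) * ω ‖y - x‖))) := by
          gcongr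
          · exact h1 y
          · exact h2 _
      _ = P * Q * Real.exp (-(l * ω ‖y‖) + -((l + 1) * ω ‖y - x‖)) := by
          rw [Real.exp_add]; ring
      _ ≤ P * Q * Real.exp (-(l * ω ‖x‖) + -ω ‖y - x‖) := by
          gcongr ?_ * Real.exp ?_
          have : ω ‖x‖ ≤ ω ‖y‖ + ω ‖y - x‖ := by
            rw [norm_sub_rev]; exact ω.apply_norm_le_add_sub x y
          nlinarith [mul_le_mul_of_nonneg_left this hl]
      _ = _ := by rw [Real.exp_add]; ring
  · rw [integral_const_mul, integral_sub_right_eq_self (fun y : Euc d => Real.exp (-ω ‖y‖)) x]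
    ring

/-- Parseval's identity. -/
lemma integral_mul_conj_eq (f g : 𝓢(Euc d, ℂ)) :
    ∫ y, g y * starRingEnd ℂ (f y) = (((2 * Real.pi)⁻¹ ^ d : ℝ) : ℂ) *
      ∫ η, angFourier g η * starRingEnd ℂ (angFourier f η) := by
  have h := SchwartzMap.integral_inner_fourier_fourier f g
  simp only [RCLike.inner_apply] at h
  rw [← h, angFourier_eq, angFourier_eq]
  have h2 := Measure.integral_comp_smul (volume : Measure (Euc d))
    (fun ξ => (FourierTransform.fourier g : 𝓢(Euc d, ℂ)) ξ *
      starRingEnd ℂ ((FourierTransform.fourier f : 𝓢(Euc d, ℂ)) ξ)) (2 * Real.pi)⁻¹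
  rw [h2, finrank_euclideanSpace_fin, Complex.real_smul, ← mul_assoc, ← Complex.ofReal_mul,
    abs_of_pos (by positivity), mul_inv_cancel₀ (by positivity), Complex.ofReal_one, one_mul]

lemma SOmega.exists_bound (f : SOmega ω d) {l : ℝ} (hl : 0 < l) :
    ∃ Q : ℝ, (∀ y, Real.exp (l * ω ‖y‖) * ‖f y‖ ≤ Q) ∧
      ∀ y, Real.exp (l * ω ‖y‖) * ‖angFourier f y‖ ≤ Q := by
  obtain ⟨A, hA⟩ := f.decay l hl 0
  obtain ⟨B, hB⟩ := f.decay_fourier l hl 0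
  refine ⟨max A B, fun y => ?_, fun y => ?_⟩
  · have := hA ⟨y, rfl⟩
    simp only [norm_iteratedFDeriv_zero] at this
    exact this.trans (le_max_left _ _)
  · have := hB ⟨y, rfl⟩
    simp only [norm_iteratedFDeriv_zero] at this
    exact this.trans (le_max_right _ _)

lemma stftFun_eq (φ g : SOmega ω d) (z : Euc d × Euc d) :
    stftFun φ g z = (((2 * Real.pi)⁻¹ ^ d : ℝ) : ℂ) *
      ∫ η, angFourier g η * starRingEnd ℂ (angFourier (φ.shift z) η) :=
  integral_mul_conj_eq (φ.shift z).toSchwartz g.toSchwartz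

/-- The defining integral yields decay `e^{-2lω(x)}` and Parseval yields `e^{-2lω(ξ)}`. The larger
of `ω(x)` and `ω(ξ)` is at least `ω(z) / 2`, which explains the doubled exponent. The bound is
linear in `P` with `K` independent of `g`, as continuity of `V_γ^* F` requires. -/
lemma exists_norm_stftFun_le (φ : SOmega ω d) {l : ℝ} (hl : 0 < l) :
    ∃ K : ℝ, 0 < K ∧ ∀ (g : SOmega ω d) z P, (∀ y, Real.exp (2 * l * ω ‖y‖) * ‖g y‖ ≤ P) →
      (∀ y, Real.exp (2 * l * ω ‖y‖) * ‖angFourier g y‖ ≤ P) →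
      ‖stftFun φ g z‖ ≤ K * P * Real.exp (-(l * ω.phase z)) := by
  obtain ⟨Q, hQ1, hQ2⟩ := φ.exists_bound (l := 2 * l + 1) (by linarith)
  set I := ∫ y : Euc d, Real.exp (-ω ‖y‖)
  have hI : 0 ≤ I := integral_nonneg fun y => (Real.exp_pos _).le
  have hQ0 : 0 ≤ Q := le_trans (by positivity) (hQ1 0)
  set c := (2 * Real.pi)⁻¹ ^ d
  have hc : 0 < c := by positivity
  refine ⟨(1 + c) * (Q * I) + 1, by positivity, fun g z P hP1 hP2 => ?_⟩
  have hP0 : 0 ≤ P := le_trans (by positivity) (hP1 0)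
  have b1 : ‖stftFun φ g z‖ ≤ P * Q * I * Real.exp (-(2 * l * ω ‖z.1‖)) :=
    norm_integral_mul_conj_le (by linarith) z.1 hP1 hQ1 fun y => by
      rw [SOmega.coe_shift]; exact norm_shiftFun z φ y
  have b2 : ‖stftFun φ g z‖ ≤ c * (P * Q * I * Real.exp (-(2 * l * ω ‖z.2‖))) := by
    rw [stftFun_eq, norm_mul, Complex.norm_real, Real.norm_of_nonneg hc.le]
    gcongr
    refine norm_integral_mul_conj_le (by linarith) z.2 hP2 hQ2 fun y => ?_
    rw [SOmega.coe_shift, angFourier_shiftFun, norm_mul, norm_mul]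
    simp [character, Complex.norm_exp]
  have h1 : P * Q * I * Real.exp (-(2 * l * ω ‖z.1‖)) ≤
      ((1 + c) * (Q * I) + 1) * P * Real.exp (-(2 * l * ω ‖z.1‖)) := by
    refine mul_le_mul_of_nonneg_right ?_ (Real.exp_pos _).le
    nlinarith [mul_nonneg hP0 (mul_nonneg hQ0 hI), mul_nonneg hc.le
      (mul_nonneg hP0 (mul_nonneg hQ0 hI))]
  have h2 : c * (P * Q * I * Real.exp (-(2 * l * ω ‖z.2‖))) ≤
      ((1 + c) * (Q * I) + 1) * P * Real.exp (-(2 * l * ω ‖z.2‖)) := by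
    rw [← mul_assoc]
    refine mul_le_mul_of_nonneg_right ?_ (Real.exp_pos _).le
    nlinarith [mul_nonneg hP0 (mul_nonneg hQ0 hI), mul_nonneg hc.le
      (mul_nonneg hP0 (mul_nonneg hQ0 hI))]
  have hph := ω.phase_le_add z
  rcases le_total (ω ‖z.1‖) (ω ‖z.2‖) with h | h
  · exact (b2.trans h2).trans (mul_le_mul_of_nonneg_left (Real.exp_le_exp.2 (by nlinarith))
      (by positivity))
  · exact (b1.trans h1).trans (mul_le_mul_of_nonneg_left (Real.exp_le_exp.2 (by nlinarith))
      (by positivity))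

lemma exists_norm_stftFun_le_exp (φ g : SOmega ω d) {l : ℝ} (hl : 0 < l) :
    ∃ K : ℝ, 0 < K ∧ ∀ z, ‖stftFun φ g z‖ ≤ K * Real.exp (-(l * ω.phase z)) := by
  obtain ⟨K, hK, h⟩ := exists_norm_stftFun_le φ hl
  obtain ⟨P, hP1, hP2⟩ := g.exists_bound (l := 2 * l) (by linarith)
  refine ⟨K * (|P| + 1), by positivity, fun z => (h g z P hP1 hP2).trans ?_⟩
  gcongr
  linarith [le_abs_self P]

lemma SOmega.integrable (f : SOmega ω d) : Integrable (f : Euc d → ℂ) := f.toSchwartz.integrable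

lemma SOmega.continuous (f : SOmega ω d) : Continuous (f : Euc d → ℂ) := f.toSchwartz.continuous

lemma SOmega.exists_norm_le (f : SOmega ω d) : ∃ B : ℝ, 0 < B ∧ ∀ y, ‖f y‖ ≤ B := by
  obtain ⟨Q, hQ, -⟩ := f.exists_bound one_pos
  refine ⟨|Q| + 1, by positivity, fun y => ?_⟩
  have h1 : 1 ≤ Real.exp (1 * ω ‖y‖) := Real.one_le_exp (by simpa using ω.apply_norm_nonneg y)
  nlinarith [hQ y, le_abs_self Q, norm_nonneg (f y)]

lemma continuous_stftFun (φ g : SOmega ω d) : Continuous (stftFun φ g) := by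
  obtain ⟨B, hB, hφ⟩ := φ.exists_norm_le
  have hc : Continuous fun p : (Euc d × Euc d) × Euc d =>
      g p.2 * starRingEnd ℂ (φ.shift p.1 p.2) := by
    simp only [SOmega.shift_apply, character]
    have h1 := g.continuous
    have h2 := φ.continuous
    fun_prop
  refine continuous_of_dominated (bound := fun y => ‖g y‖ * B)
    (fun z => (hc.comp (continuous_const.prodMk continuous_id)).aestronglyMeasurable)
    (fun z => ae_of_all _ fun y => ?_) (g.integrable.norm.mul_const B)
    (ae_of_all _ fun y => hc.comp (continuous_id.prodMk continuous_const))
  rw [norm_mul, RCLike.norm_conj, SOmega.coe_shift, norm_shiftFun]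
  gcongr
  exact hφ _

/-! ### The reconstruction formula -/

/-- Differentiation under the integral sign, to all orders. -/
lemma iteratedFDeriv_integral {Z E F : Type*} [TopologicalSpace Z] [MeasurableSpace Z]
    [OpensMeasurableSpace Z] [SecondCountableTopology Z] {μ : Measure Z}
    [NormedAddCommGroup E] [NormedSpace ℝ E] [NormedAddCommGroup F] [NormedSpace ℝ F]
    [CompleteSpace F]
    {f : Z → E → F} (hf : ∀ z (n : ℕ), ContDiff ℝ n (f z))
    (hc : ∀ n y, Continuous fun z => iteratedFDeriv ℝ n (f z) y) {B : ℕ → Z → ℝ}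
    (hB : ∀ n, Integrable (B n) μ) (hle : ∀ n z y, ‖iteratedFDeriv ℝ n (f z) y‖ ≤ B n z) (n : ℕ) :
    iteratedFDeriv ℝ n (fun y => ∫ z, f z y ∂μ) = fun y => ∫ z, iteratedFDeriv ℝ n (f z) y ∂μ := by
  have hint : ∀ n y, Integrable (fun z => iteratedFDeriv ℝ n (f z) y) μ := fun n y =>
    (hB n).mono' (hc n y).aestronglyMeasurable (ae_of_all _ fun z => hle n z y)
  induction n with
  | zero =>
    funext y
    have h := ((continuousMultilinearCurryFin0 ℝ E F).symm :
      F →L[ℝ] ContinuousMultilinearMap ℝ (fun _ : Fin 0 => E) F).integral_comp_comm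
      (μ := μ) (φ := fun z => f z y) (by
        have h1 := ((continuousMultilinearCurryFin0 ℝ E F :
          ContinuousMultilinearMap ℝ (fun _ : Fin 0 => E) F →L[ℝ] F)).integrable_comp (hint 0 y)
        exact h1.congr (ae_of_all _ fun z => by simp [iteratedFDeriv_zero_eq_comp]))
    rw [iteratedFDeriv_zero_eq_comp]
    exact h.symm
  | succ n ih =>
    funext y
    set L := ((continuousMultilinearCurryLeftEquiv ℝ (fun _ : Fin (n + 1) => E) F).symm :
        (E →L[ℝ] ContinuousMultilinearMap ℝ (fun _ : Fin n => E) F) →L[ℝ]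
          ContinuousMultilinearMap ℝ (fun _ : Fin (n + 1) => E) F)
    set L' := (continuousMultilinearCurryLeftEquiv ℝ (fun _ : Fin (n + 1) => E) F :
        ContinuousMultilinearMap ℝ (fun _ : Fin (n + 1) => E) F →L[ℝ]
          (E →L[ℝ] ContinuousMultilinearMap ℝ (fun _ : Fin n => E) F))
    have hfd : ∀ z y, fderiv ℝ (iteratedFDeriv ℝ n (f z)) y =
        L' (iteratedFDeriv ℝ (n + 1) (f z) y) := fun z y => by
      rw [iteratedFDeriv_succ_eq_comp_left]
      simp [L']
    have hd : HasFDerivAt (fun y => ∫ z, iteratedFDeriv ℝ n (f z) y ∂μ)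
        (∫ z, fderiv ℝ (iteratedFDeriv ℝ n (f z)) y ∂μ) y := by
      refine hasFDerivAt_integral_of_dominated_of_fderiv_le (𝕜 := ℝ)
        (F' := fun y z => fderiv ℝ (iteratedFDeriv ℝ n (f z)) y) (bound := B (n + 1)) univ_mem
        (Eventually.of_forall fun y => (hc n y).aestronglyMeasurable) (hint n y) ?_ ?_
        (hB (n + 1)) ?_
      · simp only [hfd]
        exact (L'.continuous.comp (hc (n + 1) y)).aestronglyMeasurable
      · refine ae_of_all _ fun z x _ => ?_
        rw [norm_fderiv_iteratedFDeriv]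
        exact hle _ _ _
      · refine ae_of_all _ fun z x _ => ?_
        exact ((ContDiff.differentiable_iteratedFDeriv (𝕜 := ℝ) (f := f z) (n := (n + 1 : ℕ))
          (by exact_mod_cast Nat.lt_succ_self n) (hf z (n + 1))) x).hasFDerivAt
    have h1 : Integrable (fun z => fderiv ℝ (iteratedFDeriv ℝ n (f z)) y) μ := by
      simp only [hfd]
      exact L'.integrable_comp (hint (n + 1) y)
    have h2 := L.integral_comp_comm h1
    rw [iteratedFDeriv_succ_eq_comp_left, ih, Function.comp_apply, hd.fderiv]
    exact h2.symm

lemma angFourier_eq_fourier (h : Euc d → ℂ) (ζ : Euc d) :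
    angFourier h ((2 * Real.pi) • ζ) = FourierTransform.fourier h ζ := by
  rw [Real.fourier_eq', angFourier]
  congr 1
  funext x
  rw [smul_eq_mul]
  congr 2
  rw [inner_smul_right]
  push_cast
  ring

/-- Fourier inversion for `angFourier`. -/
lemma integral_angFourier_mul_character {h : Euc d → ℂ} (hc : Continuous h) (hi : Integrable h)
    (hF : Integrable (angFourier h)) (y : Euc d) :
    ∫ ξ, angFourier h ξ * character ξ y = ((2 * Real.pi) ^ d : ℝ) * h y := by
  have hF' : Integrable (FourierTransform.fourier h) := by
    refine (hF.comp_smul (R := 2 * Real.pi) (by positivity)).congr (ae_of_all _ fun ζ => ?_)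
    exact angFourier_eq_fourier h ζ
  have h1 := congrFun (hc.fourierInv_fourier_eq hi hF') y
  rw [Real.fourierInv_eq'] at h1
  have h2 := Measure.integral_comp_smul (volume : Measure (Euc d))
    (fun ξ => angFourier h ξ * character ξ y) (2 * Real.pi)
  have h3 : ∀ ζ : Euc d, angFourier h ((2 * Real.pi) • ζ) * character ((2 * Real.pi) • ζ) y =
      Complex.exp ((↑(2 * Real.pi * inner ℝ ζ y) * Complex.I)) • FourierTransform.fourier h ζ := by
    intro ζ
    rw [angFourier_eq_fourier, smul_eq_mul, mul_comm, character, inner_smul_right,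
      real_inner_comm, mul_comm Complex.I]
  simp only [h3] at h2
  rw [h1, finrank_euclideanSpace_fin, abs_of_pos (by positivity), Complex.real_smul] at h2
  rw [h2, ← mul_assoc, ← Complex.ofReal_mul, mul_inv_cancel₀ (by positivity), Complex.ofReal_one,
    one_mul]

lemma integrable_of_norm_le_exp {E : Type*} [NormedAddCommGroup E] {F : Euc d × Euc d → E}
    (hF : AEStronglyMeasurable F) {C : ℝ} (ω : Weight)
    (hle : ∀ z, ‖F z‖ ≤ C * Real.exp (-ω.phase z)) : Integrable F :=
  (ω.integrable_exp_neg_phase.const_mul C).mono' hF (ae_of_all _ hle)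

lemma integrable_exp_mul_norm_stftFun (φ g : SOmega ω d) {μ : ℝ} (hμ : 0 ≤ μ) :
    Integrable fun z => Real.exp (μ * ω.phase z) * ‖stftFun φ g z‖ := by
  obtain ⟨K, hK, h⟩ := exists_norm_stftFun_le_exp φ g (l := μ + 1) (by linarith)
  refine integrable_of_norm_le_exp (C := K) ((Real.continuous_exp.comp (continuous_const.mul
    ω.continuous_phase)).mul (continuous_stftFun φ g).norm).aestronglyMeasurable ω fun z => ?_
  rw [Real.norm_of_nonneg (by positivity)]
  calc _ ≤ Real.exp (μ * ω.phase z) * (K * Real.exp (-((μ + 1) * ω.phase z))) := by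
        gcongr; exact h z
    _ = _ := by rw [mul_left_comm, ← Real.exp_add]; ring_nf

lemma integrable_stftFun (φ g : SOmega ω d) : Integrable (stftFun φ g) := by
  refine (integrable_norm_iff (continuous_stftFun φ g).aestronglyMeasurable).1 ?_
  simpa using integrable_exp_mul_norm_stftFun φ g le_rfl

/-- For fixed position the transform is a Fourier transform in the frequency, so Fourier inversion
applies to it. -/
lemma stftFun_eq_angFourier (φ g : SOmega ω d) (z : Euc d × Euc d) :
    stftFun φ g z = angFourier (fun y => g y * starRingEnd ℂ (φ (y - z.1))) z.2 := by
  unfold stftFun angFourier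
  congr 1
  funext y
  rw [SOmega.shift_apply, map_mul, character, ← Complex.exp_conj, mul_left_comm]
  simp

lemma integrable_stftFun_right (φ g : SOmega ω d) (x : Euc d) :
    Integrable fun ξ => stftFun φ g (x, ξ) := by
  obtain ⟨K, hK, h⟩ := exists_norm_stftFun_le_exp φ g one_pos
  refine (ω.integrable_exp_neg_norm.const_mul K).mono'
    ((continuous_stftFun φ g).comp (continuous_const.prodMk continuous_id)).aestronglyMeasurable
    (ae_of_all _ fun ξ => (h (x, ξ)).trans ?_)
  gcongr
  rw [one_mul]
  exact ω.apply_norm_snd_le_phase (x, ξ)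

lemma integrable_stftFun_mul_shift (φ g : SOmega ω d) (y : Euc d) :
    Integrable fun w => stftFun φ g w * φ.shift w y := by
  obtain ⟨B, hB, hφ⟩ := φ.exists_norm_le
  have hc : Continuous fun w : Euc d × Euc d => φ.shift w y := by
    simp only [SOmega.shift_apply, character]
    have h2 := φ.continuous
    fun_prop
  refine (integrable_stftFun φ g).mul_bdd (c := B) hc.aestronglyMeasurable (ae_of_all _ fun w => ?_)
  rw [SOmega.coe_shift, norm_shiftFun]
  exact hφ _

/-- The constant `(2π)^d ‖φ‖²` of the reconstruction formula. -/
def reconstructionConst (φ : SOmega ω d) : ℂ :=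
  ((2 * Real.pi) ^ d : ℝ) * ∫ y, φ y * starRingEnd ℂ (φ y)

/-- Fourier inversion in `ξ` gives `(2π)^d g(y) |φ(y - x)|²`, and the remaining integral over `x` is
`‖φ‖²`. -/
lemma integral_stftFun_mul_shift (φ g : SOmega ω d) (y : Euc d) :
    ∫ w, stftFun φ g w * φ.shift w y = reconstructionConst φ * g y := by
  have hi : Integrable (fun w => stftFun φ g w * φ.shift w y) ((volume : Measure (Euc d)).prod
    (volume : Measure (Euc d))) := integrable_stftFun_mul_shift φ g y
  rw [Measure.volume_eq_prod, integral_prod _ hi]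
  obtain ⟨B, hB, hφ⟩ := φ.exists_norm_le
  have inner : ∀ x, ∫ ξ, stftFun φ g (x, ξ) * φ.shift (x, ξ) y =
      ((2 * Real.pi) ^ d : ℝ) * g y * (φ (y - x) * starRingEnd ℂ (φ (y - x))) := by
    intro x
    have hcφ : Continuous fun y => starRingEnd ℂ (φ (y - x)) :=
      Complex.continuous_conj.comp (φ.continuous.comp (continuous_id.sub continuous_const))
    have h1 := integral_angFourier_mul_character
      (h := fun y => g y * starRingEnd ℂ (φ (y - x))) (g.continuous.mul hcφ)
      (g.integrable.mul_bdd (c := B) hcφ.aestronglyMeasurable (ae_of_all _ fun y => by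
        rw [RCLike.norm_conj]; exact hφ _))
      ((integrable_stftFun_right φ g x).congr (ae_of_all _ fun ξ =>
        stftFun_eq_angFourier φ g (x, ξ))) y
    simp only [stftFun_eq_angFourier, SOmega.shift_apply, ← mul_assoc, integral_mul_const]
    rw [h1]
    ring
  simp only [inner]
  rw [integral_const_mul, integral_sub_left_eq_self (fun t => φ t * starRingEnd ℂ (φ t)) volume y,
    reconstructionConst]
  ring

lemma reconstructionConst_ne_zero {φ : SOmega ω d} (hφ : φ ≠ 0) : reconstructionConst φ ≠ 0 := by
  have hne : ∃ y, φ y ≠ 0 := by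
    by_contra! h
    exact hφ (SOmega.ext h)
  obtain ⟨y, hy⟩ := hne
  have hpos : 0 < ∫ y, ‖φ y‖ ^ 2 := by
    obtain ⟨B, hB, hB'⟩ := φ.exists_norm_le
    refine integral_pos_of_integrable_nonneg_nonzero (x := y) (φ.continuous.norm.pow 2) ?_
      (fun y => by positivity) (by positivity)
    simp only [pow_two]
    exact φ.integrable.norm.mul_bdd (c := B) φ.continuous.norm.aestronglyMeasurable
      (ae_of_all _ fun y => by rw [norm_norm]; exact hB' y)
  have h2 : ∫ y, φ y * starRingEnd ℂ (φ y) = ((∫ y, ‖φ y‖ ^ 2 : ℝ) : ℂ) := by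
    rw [← integral_complex_ofReal]
    congr 1
    funext y
    rw [Complex.mul_conj, Complex.normSq_eq_norm_sq]
  rw [reconstructionConst, h2]
  refine mul_ne_zero ?_ ?_
  · exact Complex.ofReal_ne_zero.2 (by positivity)
  · exact Complex.ofReal_ne_zero.2 hpos.ne'

/-- Fubini pulls the Fourier integral outside and leaves the pointwise formula. Absolute convergence
holds because `V_φ g` is integrable and the `L¹` norm of a shifted window does not depend on the
shift. -/
lemma integral_stftFun_mul_angFourier_shift (φ g : SOmega ω d) (η : Euc d) :
    ∫ w, stftFun φ g w * angFourier (φ.shift w) η = reconstructionConst φ * angFourier g η := by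
  have hc : Continuous fun p : (Euc d × Euc d) × Euc d => stftFun φ g p.1 *
      (Complex.exp (-(Complex.I * (inner ℝ p.2 η : ℝ))) * φ.shift p.1 p.2) := by
    simp only [SOmega.shift_apply, character]
    have h1 := continuous_stftFun φ g
    have h2 := φ.continuous
    fun_prop
  have hn : ∀ w x, ‖stftFun φ g w *
      (Complex.exp (-(Complex.I * (inner ℝ x η : ℝ))) * φ.shift w x)‖ =
        ‖stftFun φ g w‖ * ‖φ (x - w.1)‖ := by
    intro w x
    rw [norm_mul, norm_mul, SOmega.coe_shift, norm_shiftFun]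
    simp [Complex.norm_exp]
  have hi : Integrable (fun p : (Euc d × Euc d) × Euc d => stftFun φ g p.1 *
      (Complex.exp (-(Complex.I * (inner ℝ p.2 η : ℝ))) * φ.shift p.1 p.2))
      ((volume : Measure (Euc d × Euc d)).prod volume) := by
    rw [integrable_prod_iff hc.aestronglyMeasurable]
    refine ⟨ae_of_all _ fun w => ?_, ?_⟩
    · refine (integrable_norm_iff (hc.comp (continuous_const.prodMk
        continuous_id)).aestronglyMeasurable).1 ?_
      simp only [Function.comp_def, id, hn]
      exact (φ.integrable.comp_sub_right w.1).norm.const_mul _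
    · simp only [hn, integral_const_mul]
      have : ∀ w : Euc d × Euc d, ∫ x, ‖φ (x - w.1)‖ = ∫ x, ‖φ x‖ := fun w =>
        integral_sub_right_eq_self (fun x => ‖φ x‖) w.1
      simp only [this]
      exact (integrable_stftFun φ g).norm.mul_const _
  simp only [angFourier, ← integral_const_mul]
  rw [integral_integral_swap hi]
  congr 1
  funext x
  simp only [mul_left_comm _ (Complex.exp _)]
  rw [integral_const_mul, integral_stftFun_mul_shift]

lemma integral_stftFun_mul_side_shift (i : SemiIdx) (φ g : SOmega ω d) (y : Euc d) :
    ∫ w, stftFun φ g w * i.side (φ.shift w) y = reconstructionConst φ * i.side g y := by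
  rcases i with i | i
  · exact integral_stftFun_mul_shift φ g y
  · exact integral_stftFun_mul_angFourier_shift φ g y

/-- Differentiation under the integral is allowed because `V_φ g` decays faster than the derivatives
of the shifted windows grow. -/
lemma integral_stftFun_smul_iteratedFDeriv (i : SemiIdx) (φ g : SOmega ω d) (n : ℕ) (y : Euc d) :
    ∫ w, stftFun φ g w • iteratedFDeriv ℝ n (i.side (φ.shift w)) y =
      reconstructionConst φ • iteratedFDeriv ℝ n (i.side g) y := by
  choose C hC hle using fun n => φ.exists_iteratedFDeriv_side_shift_le i one_pos n
  have hsm : ∀ w n y, iteratedFDeriv ℝ n (stftFun φ g w • i.side (φ.shift w)) y =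
      stftFun φ g w • iteratedFDeriv ℝ n (i.side (φ.shift w)) y := fun w n y =>
    iteratedFDeriv_const_smul_apply ((φ.shift w).side_contDiff i n).contDiffAt
  have h := iteratedFDeriv_integral (μ := (volume : Measure (Euc d × Euc d)))
    (f := fun w => stftFun φ g w • i.side (φ.shift w))
    -- The shift estimate is used with `l = 1`, hence the exponent `1 + 1`; its factor `e^{ω(y)} ≥
    -- 1` is discarded.
    (B := fun n w => C n * (Real.exp ((1 + 1) * ω.phase w) * ‖stftFun φ g w‖))
    (fun w n => ((φ.shift w).side_contDiff i n).const_smul (stftFun φ g w))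
    (fun n y => by
      simp only [hsm]
      have h0 : Continuous fun w : Euc d × Euc d => (w, y) := continuous_id.prodMk continuous_const
      have h1 := (φ.continuous_iteratedFDeriv_side_shift i n).comp h0
      exact (continuous_stftFun φ g).smul h1)
    (fun n => (integrable_exp_mul_norm_stftFun φ g (by norm_num)).const_mul _)
    (fun n w y => by
      rw [hsm, norm_smul]
      have h1 : 1 ≤ Real.exp (1 * ω ‖y‖) :=
        Real.one_le_exp (by simpa using ω.apply_norm_nonneg y)
      have h2 : ‖iteratedFDeriv ℝ n (i.side (φ.shift w)) y‖ ≤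
          C n * Real.exp ((1 + 1) * ω.phase w) :=
        (le_mul_of_one_le_left (norm_nonneg _) h1).trans (hle n w y)
      calc _ ≤ ‖stftFun φ g w‖ * (C n * Real.exp ((1 + 1) * ω.phase w)) := by gcongr
        _ = _ := by ring) n
  have h2 : (fun y => ∫ w, (stftFun φ g w • i.side (φ.shift w)) y) =
      reconstructionConst φ • i.side g :=
    funext fun y => integral_stftFun_mul_side_shift i φ g y
  rw [h2] at h
  have h3 := congrFun h y
  simp only [hsm] at h3
  rw [← h3, iteratedFDeriv_const_smul_apply (g.side_contDiff i n).contDiffAt]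

/-- The reconstruction formula, tested against a distribution. -/
lemma integral_stftFun_mul_apply_shift (φ g : SOmega ω d) (u : DOmega ω d) :
    ∫ w, stftFun φ g w * u (φ.shift w) = reconstructionConst φ * u g := by
  obtain ⟨s, U, hU⟩ := SOmega.exists_extension u
  obtain ⟨C, μ, hC, hμ, h⟩ := SOmega.exists_norm_components_shift_le s φ
  -- The integral is taken in the Banach space on which `U` lives, so `U` commutes with it. Its
  -- value is identified by applying the evaluation at each point to each component.
  have hi : Integrable fun w => stftFun φ g w • SOmega.components s (φ.shift w) := by
    refine ((integrable_exp_mul_norm_stftFun φ g hμ.le).const_mul C).mono'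
      ((continuous_stftFun φ g).smul
        (SOmega.continuous_components_shift s φ)).aestronglyMeasurable
      (ae_of_all _ fun w => ?_)
    rw [norm_smul]
    calc _ ≤ ‖stftFun φ g w‖ * (C * Real.exp (μ * ω.phase w)) := by gcongr; exact h w
      _ = _ := by ring
  have key : ∫ w, stftFun φ g w • SOmega.components s (φ.shift w) =
      reconstructionConst φ • SOmega.components s g := by
    funext i
    ext1 y
    set ev : SOmega.CompSpace d s →L[ℂ]
        ContinuousMultilinearMap ℝ (fun _ : Fin i.1.order => Euc d) ℂ :=
      (BoundedContinuousFunction.evalCLM ℂ y).comp (SOmega.CompSpace.proj i)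
    have h1 := ev.integral_comp_comm hi
    change ev (∫ w, stftFun φ g w • SOmega.components s (φ.shift w)) =
      ev (reconstructionConst φ • SOmega.components s g)
    rw [← h1]
    have h2 : ∀ (c : ℂ) (f : SOmega ω d), ev (c • SOmega.components s f) =
        Real.exp (i.1.expo * ω ‖y‖) • (c • iteratedFDeriv ℝ i.1.order (i.1.side f) y) := by
      intro c f
      rw [map_smul, smul_comm]
      rfl
    simp only [h2]
    rw [integral_smul, integral_stftFun_smul_iteratedFDeriv]
  have h3 := U.integral_comp_comm hi
  rw [key] at h3
  simp only [map_smul, smul_eq_mul, ← hU] at h3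
  exact h3

/-! ### Adjoints of the short-time Fourier transform -/

lemma stftFun_conj (φ g : SOmega ω d) (z : Euc d × Euc d) :
    stftFun φ.conj g.conj (conjPoint z) = starRingEnd ℂ (stftFun φ g z) := by
  unfold stftFun
  rw [← integral_conj, ← SOmega.conj_shift]
  simp only [SOmega.conj_apply, map_mul]

lemma measurePreserving_conjPoint :
    MeasurePreserving (conjPoint : Euc d × Euc d → Euc d × Euc d) :=
  (MeasurePreserving.id volume).prod (Measure.measurePreserving_neg volume)

lemma measurableEmbedding_conjPoint :
    MeasurableEmbedding (conjPoint : Euc d × Euc d → Euc d × Euc d) := by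
  have hinv : Function.Involutive (conjPoint : Euc d × Euc d → Euc d × Euc d) := fun z => by
    simp [conjPoint]
  exact (MeasurableEquiv.mk hinv.toPerm continuous_conjPoint.measurable
    continuous_conjPoint.measurable).measurableEmbedding

lemma integrable_mul_conj_stftFun {F : Euc d × Euc d → ℂ} (hF : AEStronglyMeasurable F)
    {C μ : ℝ} (hμ : 0 ≤ μ) (hle : ∀ z, ‖F z‖ ≤ C * Real.exp (μ * ω.phase z)) (γ g : SOmega ω d) :
    Integrable fun z => F z * starRingEnd ℂ (stftFun γ g z) := by
  refine ((integrable_exp_mul_norm_stftFun γ g hμ).const_mul C).mono'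
    (hF.mul (Complex.continuous_conj.comp (continuous_stftFun γ g)).aestronglyMeasurable)
    (ae_of_all _ fun z => ?_)
  rw [norm_mul, RCLike.norm_conj, ← mul_assoc]
  gcongr
  exact hle z

/-- The measure-preserving reflection `conjPoint` turns the integral into the linear reconstruction
formula for `φ.conj` and `g.conj`, which is why the constant belongs to the conjugate window. -/
lemma integral_stft_mul_conj_stftFun (φ g : SOmega ω d) (u : DOmega ω d) :
    ∫ z, stft φ u z * starRingEnd ℂ (stftFun φ g z) =
      reconstructionConst φ.conj * pairing u g := by
  rw [pairing, ← integral_stftFun_mul_apply_shift φ.conj g.conj u,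
    ← measurePreserving_conjPoint.integral_comp measurableEmbedding_conjPoint
      (fun w => stftFun φ.conj g.conj w * u (φ.conj.shift w))]
  congr 1
  funext z
  rw [stft_eq, stftFun_conj, mul_comm]

/-- A multiple of `u` is recovered from its short-time Fourier transform. -/
lemma isAdjointSTFT_stft (φ : SOmega ω d) (u : DOmega ω d) :
    IsAdjointSTFT φ (stft φ u) (reconstructionConst φ.conj • u) := by
  intro g
  obtain ⟨C, μ, hC, hμ, h⟩ := exists_norm_stft_le φ u
  refine ⟨integrable_mul_conj_stftFun (continuous_stft φ u).aestronglyMeasurable hμ.le h φ g, ?_⟩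
  rw [integral_stft_mul_conj_stftFun]
  rfl

/-! ### Existence and uniqueness -/

lemma IsAdjointSTFT.unique {γ : SOmega ω d} {F : Euc d × Euc d → ℂ} {v v' : DOmega ω d}
    (h : IsAdjointSTFT γ F v) (h' : IsAdjointSTFT γ F v') : v = v' := by
  ext g
  have h1 : pairing v g.conj = pairing v' g.conj := by rw [(h _).2, (h' _).2]
  simpa only [pairing, SOmega.conj_conj] using h1

lemma conj_stftFun_conj (γ f : SOmega ω d) (z : Euc d × Euc d) :
    starRingEnd ℂ (stftFun γ f.conj z) = ∫ y, f y * γ.shift z y := by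
  unfold stftFun
  rw [← integral_conj]
  simp [SOmega.conj_apply]

lemma conj_stftFun_conj_add (γ f g : SOmega ω d) (z : Euc d × Euc d) :
    starRingEnd ℂ (stftFun γ (f + g).conj z) =
      starRingEnd ℂ (stftFun γ f.conj z) + starRingEnd ℂ (stftFun γ g.conj z) := by
  have hi : ∀ f : SOmega ω d, Integrable fun y => f y * γ.shift z y := fun f => by
    obtain ⟨B, hB, hγ⟩ := (γ.shift z).exists_norm_le
    exact f.integrable.mul_bdd (c := B) (γ.shift z).continuous.aestronglyMeasurable
      (ae_of_all _ hγ)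
  rw [conj_stftFun_conj, conj_stftFun_conj, conj_stftFun_conj, ← integral_add (hi f) (hi g)]
  congr 1
  funext y
  exact add_mul _ _ _

lemma conj_stftFun_conj_smul (γ f : SOmega ω d) (c : ℂ) (z : Euc d × Euc d) :
    starRingEnd ℂ (stftFun γ (c • f).conj z) = c * starRingEnd ℂ (stftFun γ f.conj z) := by
  rw [conj_stftFun_conj, conj_stftFun_conj, ← integral_const_mul]
  congr 1
  funext y
  exact mul_assoc _ _ _

/-- The decay `e^{-(μ+1)ω}` of the transform of a test function beats the growth of `F` with an
integrable `e^{-ω}` to spare, and its constant is bounded by two seminorms of the test function. -/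
lemma exists_isAdjointSTFT {F : Euc d × Euc d → ℂ} (hF : AEStronglyMeasurable F)
    {C μ : ℝ} (hμ : 0 ≤ μ) (hle : ∀ z, ‖F z‖ ≤ C * Real.exp (μ * ω.phase z)) (γ : SOmega ω d) :
    ∃ v : DOmega ω d, IsAdjointSTFT γ F v := by
  have hi := integrable_mul_conj_stftFun hF hμ hle γ
  have hC : 0 ≤ C := nonneg_of_mul_nonneg_left ((norm_nonneg _).trans (hle 0)) (Real.exp_pos _)
  -- The argument is conjugated because `pairing v g = v g.conj`; this also makes `T` linear rather
  -- than antilinear.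
  let T : SOmega ω d →ₗ[ℂ] ℂ :=
    { toFun := fun g => ∫ z, F z * starRingEnd ℂ (stftFun γ g.conj z)
      map_add' := fun f g => by
        simp only [conj_stftFun_conj_add, mul_add]
        exact integral_add (hi _) (hi _)
      map_smul' := fun c f => by
        simp only [conj_stftFun_conj_smul, mul_left_comm _ c, RingHom.id_apply, smul_eq_mul]
        exact integral_const_mul _ _ }
  obtain ⟨K, hK, hKle⟩ := exists_norm_stftFun_le γ (l := μ + 1) (by linarith)
  set I := ∫ z : Euc d × Euc d, Real.exp (-ω.phase z)
  have hI : 0 ≤ I := integral_nonneg fun z => (Real.exp_pos _).le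
  -- Decay of the transform at rate `μ + 1` requires twice that rate from the test function and from
  -- its Fourier transform.
  have hl : 0 < 2 * (μ + 1) := by linarith
  set i₁ : SemiIdx := Sum.inl (⟨2 * (μ + 1), hl⟩, 0)
  set i₂ : SemiIdx := Sum.inr (⟨2 * (μ + 1), hl⟩, 0)
  set p : Seminorm ℂ (SOmega ω d) :=
    SOmega.seminormFamily ω d i₁ + SOmega.seminormFamily ω d i₂
  have hp : Continuous p :=
    (SOmega.withSeminorms.continuous_seminorm i₁).add
      (SOmega.withSeminorms.continuous_seminorm i₂)
  have hstft : ∀ (g : SOmega ω d) z, ‖stftFun γ g.conj z‖ ≤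
      K * p g * Real.exp (-((μ + 1) * ω.phase z)) := by
    intro g z
    refine hKle g.conj z (p g) (fun y => ?_) (fun y => ?_)
    · have h1 : Real.exp (2 * (μ + 1) * ω ‖y‖) * ‖iteratedFDeriv ℝ 0 (g : Euc d → ℂ) y‖ ≤ _ :=
        SOmega.le_seminormFamily i₁ g y
      rw [norm_iteratedFDeriv_zero] at h1
      rw [SOmega.conj_apply, RCLike.norm_conj]
      exact h1.trans (le_add_of_nonneg_right (apply_nonneg _ _))
    · have h1 : Real.exp (2 * (μ + 1) * ω ‖-y‖) * ‖iteratedFDeriv ℝ 0 (angFourier g) (-y)‖ ≤ _ :=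
        SOmega.le_seminormFamily i₂ g (-y)
      rw [norm_iteratedFDeriv_zero, norm_neg] at h1
      have h2 : angFourier g.conj y = starRingEnd ℂ (angFourier g (-y)) := angFourier_conj g y
      rw [h2, RCLike.norm_conj]
      exact h1.trans (le_add_of_nonneg_left (apply_nonneg _ _))
  have hT : ∀ g, ‖T g‖ ≤ C * K * I * p g := by
    intro g
    refine (norm_integral_le_of_norm_le (ω.integrable_exp_neg_phase.const_mul (C * K * p g))
      (ae_of_all _ fun z => ?_)).trans (le_of_eq ?_)
    · rw [norm_mul, RCLike.norm_conj]
      calc _ ≤ (C * Real.exp (μ * ω.phase z)) *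
            (K * p g * Real.exp (-((μ + 1) * ω.phase z))) := by
            gcongr
            · exact hle z
            · exact hstft g z
        _ = C * K * p g * (Real.exp (μ * ω.phase z) * Real.exp (-((μ + 1) * ω.phase z))) := by
            ring
        _ = _ := by rw [← Real.exp_add]; ring_nf
    · rw [integral_const_mul]; ring
  have : IsTopologicalAddGroup (SOmega ω d) := SOmega.withSeminorms.topologicalAddGroup
  have hTc : Continuous T := by
    refine continuous_of_tendsto_nhds_zero T ?_
    refine squeeze_zero_norm hT ?_
    simpa using (hp.tendsto 0).const_mul (C * K * I)
  refine ⟨⟨T, hTc⟩, fun g => ⟨hi g, ?_⟩⟩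
  change ∫ z, F z * starRingEnd ℂ (stftFun γ g.conj.conj z) = _
  rw [SOmega.conj_conj]

/-! ### Wave front sets -/

/-- `F` decays faster than `e^{-lω}` for every `l` on the set `Γ`. -/
def RapidOn (ω : Weight) (F : Euc d × Euc d → ℂ) (Γ : Set (Euc d × Euc d)) : Prop :=
  ∀ l : ℝ, 0 < l → BddAbove ((fun z => Real.exp (l * ω (phaseNorm z)) * ‖F z‖) '' Γ)

lemma RapidOn.exists_le {F : Euc d × Euc d → ℂ} {Γ : Set (Euc d × Euc d)} (h : RapidOn ω F Γ)
    {l : ℝ} (hl : 0 < l) :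
    ∃ C : ℝ, 0 < C ∧ ∀ z ∈ Γ, ‖F z‖ ≤ C * Real.exp (-(l * ω.phase z)) := by
  obtain ⟨A, hA⟩ := h l hl
  refine ⟨|A| + 1, by positivity, fun z hz => ?_⟩
  rw [Real.exp_neg, ← div_eq_mul_inv, le_div_iff₀ (Real.exp_pos _), mul_comm]
  exact (hA ⟨z, hz, rfl⟩).trans (by linarith [le_abs_self A])

lemma rapidOn_of_le {F : Euc d × Euc d → ℂ} {Γ : Set (Euc d × Euc d)}
    (h : ∀ l : ℝ, 0 < l → ∃ C : ℝ, ∀ z ∈ Γ, ‖F z‖ ≤ C * Real.exp (-(l * ω.phase z))) :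
    RapidOn ω F Γ := by
  intro l hl
  obtain ⟨C, hC⟩ := h l hl
  refine ⟨C, ?_⟩
  rintro _ ⟨z, hz, rfl⟩
  have := hC z hz
  rwa [Real.exp_neg, ← div_eq_mul_inv, le_div_iff₀ (Real.exp_pos _), mul_comm] at this

lemma not_mem_waveFrontSet_iff {φ : SOmega ω d} {u : DOmega ω d} {z₀ : Euc d × Euc d}
    (hz : z₀ ≠ 0) : z₀ ∉ waveFrontSet φ u ↔
      ∃ Γ, IsOpenCone Γ ∧ z₀ ∈ Γ ∧ RapidOn ω (stft φ u) Γ := by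
  simp only [waveFrontSet, mem_ofPred_eq, not_and, not_not]
  exact ⟨fun h => h hz, fun h _ => h⟩

/-- Around every point of an open cone there is a smaller open cone whose points `z` have distance
at least `|z| / N` from the complement of the given one. -/
lemma exists_isOpenCone_separated {Γ : Set (Euc d × Euc d)} (hΓ : IsOpenCone Γ)
    {z₀ : Euc d × Euc d} (hz₀ : z₀ ∈ Γ) :
    ∃ (Γ' : Set (Euc d × Euc d)) (N : ℕ), IsOpenCone Γ' ∧ z₀ ∈ Γ' ∧
      ∀ z ∈ Γ', ∀ w ∉ Γ, phaseNorm z ≤ N * phaseNorm (z - w) := by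
  obtain ⟨ho, h0, hcone⟩ := hΓ
  have hz0 : z₀ ≠ 0 := fun h => h0 (h ▸ hz₀)
  obtain ⟨ε, hε, hball⟩ := Metric.isOpen_iff.1 ho z₀ hz₀
  have hpos := phaseNorm_pos hz0
  -- The smaller cone is generated by the points `y ≠ 0` within `ε / 2` of `z₀` with norm below
  -- `|z₀| + 1`. After rescaling, a point outside `Γ` is at least `ε / 2` away from `y`, and `N * (ε
  -- / 2)` exceeds `|z₀| + 1`.
  obtain ⟨N, hN⟩ := exists_nat_gt (2 * (phaseNorm z₀ + 1) / ε)
  refine ⟨{z | ∃ t : ℝ, 0 < t ∧ ∃ y, t • y = z ∧ dist y z₀ < ε / 2 ∧ phaseNorm y < phaseNorm z₀ + 1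
    ∧ y ≠ 0}, N, ⟨?_, ?_, ?_⟩, ?_, ?_⟩
  · have hU : IsOpen {y : Euc d × Euc d | dist y z₀ < ε / 2 ∧ phaseNorm y < phaseNorm z₀ + 1
        ∧ y ≠ 0} :=
      (isOpen_lt (continuous_id.dist continuous_const) continuous_const).inter
        ((isOpen_lt continuous_phaseNorm continuous_const).inter isOpen_ne)
    have : {z | ∃ t : ℝ, 0 < t ∧ ∃ y : Euc d × Euc d, t • y = z ∧ dist y z₀ < ε / 2 ∧
        phaseNorm y < phaseNorm z₀ + 1 ∧ y ≠ 0} = ⋃ t ∈ Ioi (0 : ℝ), (fun y => t • y) ''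
          {y : Euc d × Euc d | dist y z₀ < ε / 2 ∧ phaseNorm y < phaseNorm z₀ + 1 ∧ y ≠ 0} := by
      ext z
      simp only [mem_ofPred_eq, mem_iUnion, mem_Ioi, mem_image, exists_prop]
      exact ⟨fun ⟨t, ht, y, h1, h2⟩ => ⟨t, ht, y, h2, h1⟩,
        fun ⟨t, ht, y, h2, h1⟩ => ⟨t, ht, y, h1, h2⟩⟩
    rw [this]
    exact isOpen_biUnion fun t ht => isOpenMap_smul₀ (ne_of_gt ht) _ hU
  · rintro ⟨t, ht, y, h1, -, -, hy⟩
    exact (smul_ne_zero ht.ne' hy) h1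
  · rintro z ⟨t, ht, y, rfl, hy⟩ s hs
    exact ⟨s * t, mul_pos hs ht, y, mul_smul _ _ _, hy⟩
  · exact ⟨1, one_pos, z₀, one_smul _ _, by simpa using half_pos hε, by linarith, hz0⟩
  · rintro z ⟨t, ht, y, rfl, hy1, hy2, hy3⟩ w hw
    have hw' : t⁻¹ • w ∉ Γ := fun h => hw (by
      have := hcone _ h t ht
      rwa [smul_inv_smul₀ ht.ne'] at this)
    have hd : ε ≤ dist (t⁻¹ • w) z₀ := by
      by_contra! h
      exact hw' (hball h)
    have hd2 : ε / 2 ≤ phaseNorm (y - t⁻¹ • w) := by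
      refine le_trans ?_ (norm_le_phaseNorm _)
      rw [← dist_eq_norm, dist_comm]
      linarith [dist_triangle (t⁻¹ • w) y z₀]
    have he : t • y - w = t • (y - t⁻¹ • w) := by rw [smul_sub, smul_inv_smul₀ ht.ne']
    rw [he, phaseNorm_smul, phaseNorm_smul, abs_of_pos ht, mul_left_comm]
    refine mul_le_mul_of_nonneg_left ?_ ht.le
    rw [div_lt_iff₀ hε] at hN
    have : (N : ℝ) * (ε / 2) ≤ N * phaseNorm (y - t⁻¹ • w) := by gcongr
    linarith

/-- Covariance: shifting the function translates its transform up to a unimodular factor. The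
transform of `V_γ^* F` is thereby controlled by a convolution. -/
lemma norm_stftFun_shift (γ φ : SOmega ω d) (z w : Euc d × Euc d) :
    ‖stftFun γ (φ.shift z) w‖ = ‖stftFun γ φ (w - z)‖ := by
  have h : stftFun γ (φ.shift z) w = character (z.2 - w.2) z.1 * stftFun γ φ (w - z) := by
    unfold stftFun
    rw [← integral_const_mul, ← integral_add_right_eq_self _ z.1]
    congr 1
    funext y
    simp only [SOmega.shift_apply, character, map_mul, ← Complex.exp_conj, add_sub_cancel_right,
      Prod.fst_sub, Prod.snd_sub]
    rw [show y + z.1 - w.1 = y - (w.1 - z.1) by abel]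
    have : Complex.exp (Complex.I * (inner ℝ (y + z.1) z.2 : ℝ)) *
        Complex.exp (starRingEnd ℂ (Complex.I * (inner ℝ (y + z.1) w.2 : ℝ))) =
        Complex.exp (Complex.I * (inner ℝ z.1 (z.2 - w.2) : ℝ)) *
          Complex.exp (starRingEnd ℂ (Complex.I * (inner ℝ y (w.2 - z.2) : ℝ))) := by
      rw [← Complex.exp_add, ← Complex.exp_add]
      congr 1
      simp only [map_mul, Complex.conj_I, Complex.conj_ofReal, inner_add_left, inner_sub_right]
      push_cast
      ring
    simp only [map_mul] at this
    linear_combination (φ y * starRingEnd ℂ (γ (y - (w.1 - z.1)))) * this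
  rw [h, norm_mul]
  simp [character, Complex.norm_exp]

lemma Weight.phase_le_of_phaseNorm_le (ω : Weight) {N : ℕ} {z w : Euc d × Euc d}
    (h : phaseNorm z ≤ N * phaseNorm w) : ω.phase z ≤ ω 0 + N * ω.phase w :=
  (ω.monotoneOn (phaseNorm_nonneg z) (mul_nonneg N.cast_nonneg (phaseNorm_nonneg w)) h).trans
    (ω.apply_nsmul_le N (phaseNorm_nonneg w))

/-- Rapid decay of `F` near a direction is inherited by the short-time Fourier transform of
`V_γ^* F`. -/
lemma IsAdjointSTFT.exists_rapidOn {γ : SOmega ω d} {F : Euc d × Euc d → ℂ} {v : DOmega ω d}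
    (hv : IsAdjointSTFT γ F v) {C μ : ℝ} (hμ : 0 ≤ μ)
    (hle : ∀ z, ‖F z‖ ≤ C * Real.exp (μ * ω.phase z)) {Γ : Set (Euc d × Euc d)}
    (hΓ : IsOpenCone Γ) (hF : RapidOn ω F Γ) {z₀ : Euc d × Euc d} (hz₀ : z₀ ∈ Γ)
    (φ : SOmega ω d) :
    ∃ Γ', IsOpenCone Γ' ∧ z₀ ∈ Γ' ∧ RapidOn ω (stft φ v) Γ' := by
  obtain ⟨Γ', N, hΓ', hz', hsep⟩ := exists_isOpenCone_separated hΓ hz₀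
  have hC : 0 ≤ C := nonneg_of_mul_nonneg_left ((norm_nonneg _).trans (hle 0)) (Real.exp_pos _)
  refine ⟨Γ', hΓ', hz', rapidOn_of_le fun l hl => ?_⟩
  obtain ⟨A, hA, hAle⟩ := hF.exists_le hl
  -- Of this exponent, `(l + μ) * N` pays for `(l + μ) ω(z)` when `w ∉ Γ`. The summand `l + μ`
  -- covers the cost of passing between `w` and `z`, which is `l` inside `Γ` and `μ` outside. The
  -- final `1` leaves an integrable factor.
  obtain ⟨K, hK, hKle⟩ := exists_norm_stftFun_le_exp γ φ (l := (l + μ) * N + (l + μ) + 1)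
    (by positivity)
  set I := ∫ z : Euc d × Euc d, Real.exp (-ω.phase z)
  set D := A * K + C * K * Real.exp ((l + μ) * ω 0)
  refine ⟨D * I, fun z hz => ?_⟩
  have hI : Integrable fun w => D * Real.exp (-(l * ω.phase z)) * Real.exp (-ω.phase (w - z)) :=
    (ω.integrable_exp_neg_phase.comp_sub_right z).const_mul _
  rw [stft, (hv _).2]
  refine (norm_integral_le_of_norm_le hI (ae_of_all _ fun w => ?_)).trans (le_of_eq ?_)
  · rw [norm_mul, RCLike.norm_conj, norm_stftFun_shift]
    have hs := hKle (w - z)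
    have hp0 := ω.phase_nonneg (w - z)
    have hsub : ω.phase (z - w) = ω.phase (w - z) := by rw [← ω.phase_neg, neg_sub]
    have hlm : 0 ≤ (l + μ) * N * ω.phase (w - z) := by positivity
    by_cases hw : w ∈ Γ
    -- Inside `Γ` the decay of `F` at `w` is transferred to `z` by subadditivity, at the expense of
    -- the kernel.
    · have h1 : ω.phase z ≤ ω.phase w + ω.phase (w - z) := hsub ▸ ω.phase_le_add_sub z w
      calc _ ≤ (A * Real.exp (-(l * ω.phase w))) *
            (K * Real.exp (-(((l + μ) * N + (l + μ) + 1) * ω.phase (w - z)))) := by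
            gcongr
            exact hAle w hw
        _ = A * K * Real.exp (-(l * ω.phase w) +
              -(((l + μ) * N + (l + μ) + 1) * ω.phase (w - z))) := by
            rw [Real.exp_add]; ring
        _ ≤ A * K * Real.exp (-(l * ω.phase z) + -ω.phase (w - z)) := by
            refine mul_le_mul_of_nonneg_left (Real.exp_le_exp.2 ?_) (by positivity)
            nlinarith [mul_le_mul_of_nonneg_left h1 hl.le, mul_nonneg hμ hp0]
        _ = A * K * (Real.exp (-(l * ω.phase z)) * Real.exp (-ω.phase (w - z))) := by
            rw [Real.exp_add]
        _ ≤ D * (Real.exp (-(l * ω.phase z)) * Real.exp (-ω.phase (w - z))) := by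
            gcongr
            exact le_add_of_nonneg_right (by positivity)
        _ = _ := by ring
    -- Outside `Γ` only the growth bound on `F` is available, but `w - z` is comparable to `z` in
    -- size, so the decay of the kernel yields decay in `z`.
    · have h1 : ω.phase w ≤ ω.phase z + ω.phase (w - z) := ω.phase_le_add_sub w z
      have h2 : ω.phase z ≤ ω 0 + N * ω.phase (w - z) :=
        hsub ▸ ω.phase_le_of_phaseNorm_le (hsep z hz w hw)
      calc _ ≤ (C * Real.exp (μ * ω.phase w)) *
            (K * Real.exp (-(((l + μ) * N + (l + μ) + 1) * ω.phase (w - z)))) := by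
            gcongr
            exact hle w
        _ = C * K * Real.exp (μ * ω.phase w +
              -(((l + μ) * N + (l + μ) + 1) * ω.phase (w - z))) := by
            rw [Real.exp_add]; ring
        _ ≤ C * K * Real.exp ((l + μ) * ω 0 + (-(l * ω.phase z) + -ω.phase (w - z))) := by
            refine mul_le_mul_of_nonneg_left (Real.exp_le_exp.2 ?_) (by positivity)
            nlinarith [mul_le_mul_of_nonneg_left h1 hμ,
              mul_le_mul_of_nonneg_left h2 (add_nonneg hl.le hμ), mul_nonneg hl.le hp0]
        _ = C * K * Real.exp ((l + μ) * ω 0) *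
              (Real.exp (-(l * ω.phase z)) * Real.exp (-ω.phase (w - z))) := by
            rw [Real.exp_add, Real.exp_add]; ring
        _ ≤ D * (Real.exp (-(l * ω.phase z)) * Real.exp (-ω.phase (w - z))) := by
            gcongr
            exact le_add_of_nonneg_left (by positivity)
        _ = _ := by ring
  · rw [integral_const_mul,
      integral_sub_right_eq_self (fun w : Euc d × Euc d => Real.exp (-ω.phase w)) z]
    ring

lemma RapidOn.mul_of_growth {F a : Euc d × Euc d → ℂ} {Γ : Set (Euc d × Euc d)}
    (h : RapidOn ω F Γ) {C τ : ℝ} (hτ : 0 < τ) (hC : 0 < C)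
    (ha : ∀ z, ‖a z‖ ≤ C * Real.exp (τ * ω.phase z)) : RapidOn ω (fun z => a z * F z) Γ := by
  refine rapidOn_of_le fun l hl => ?_
  -- The growth of `a` consumes the extra `τ`.
  obtain ⟨A, hA, hle⟩ := h.exists_le (l := l + τ) (by positivity)
  refine ⟨C * A, fun z hz => ?_⟩
  rw [norm_mul]
  calc _ ≤ (C * Real.exp (τ * ω.phase z)) * (A * Real.exp (-((l + τ) * ω.phase z))) := by
        gcongr
        · exact ha z
        · exact hle z hz
    _ = C * A * (Real.exp (τ * ω.phase z) * Real.exp (-((l + τ) * ω.phase z))) := by ring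
    _ = _ := by rw [← Real.exp_add]; ring_nf

/-- Rapid decay of the short-time Fourier transform near a direction does not depend on the
window. -/
lemma exists_rapidOn_stft {θ : SOmega ω d} (hθ : θ ≠ 0) {u : DOmega ω d}
    {Γ : Set (Euc d × Euc d)} (hΓ : IsOpenCone Γ) (hu : RapidOn ω (stft θ u) Γ)
    {z₀ : Euc d × Euc d} (hz₀ : z₀ ∈ Γ) (ψ : SOmega ω d) :
    ∃ Γ', IsOpenCone Γ' ∧ z₀ ∈ Γ' ∧ RapidOn ω (stft ψ u) Γ' := by
  obtain ⟨C, μ, -, hμ, hle⟩ := exists_norm_stft_le θ u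
  -- Here `F = V_θ u`, whose adjoint transform with the same window `θ` is a constant multiple of
  -- `u`; the constant is divided out below.
  obtain ⟨Γ', hΓ', hz', h⟩ :=
    (isAdjointSTFT_stft θ u).exists_rapidOn hμ.le hle hΓ hu hz₀ ψ
  refine ⟨Γ', hΓ', hz', rapidOn_of_le fun l hl => ?_⟩
  obtain ⟨A, -, hA⟩ := h.exists_le hl
  have hθ' : θ.conj ≠ 0 := fun h0 => hθ <| by
    rw [← θ.conj_conj, h0]
    exact SOmega.ext fun y => map_zero (starRingEnd ℂ)
  have hc : 0 < ‖reconstructionConst θ.conj‖ := norm_pos_iff.2 (reconstructionConst_ne_zero hθ')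
  refine ⟨‖reconstructionConst θ.conj‖⁻¹ * A, fun z hz => ?_⟩
  have h1 : stft ψ (reconstructionConst θ.conj • u) z = reconstructionConst θ.conj * stft ψ u z :=
    rfl
  have h2 := hA z hz
  rw [h1, norm_mul] at h2
  rw [mul_assoc, inv_mul_eq_div, le_div_iff₀ hc, mul_comm]
  exact h2

end GaborWF

end

/-! ### Localization operators do not enlarge the wave front set -/

theorem mainTheorem8 (d : ℕ) (ω : GaborWF.Weight) (ψ γ : GaborWF.SOmega ω d)
    (hψ : ψ ≠ 0) (hγ : γ ≠ 0)
    (a : GaborWF.Euc d × GaborWF.Euc d → ℂ) (ha : AEMeasurable a)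
    (τ C : ℝ) (hτ : 0 < τ) (hC : 0 < C)
    (hbound : ∀ z, ‖a z‖ ≤ C * Real.exp (τ * ω (GaborWF.phaseNorm z)))
    (u : GaborWF.DOmega ω d) :
    (∃! v : GaborWF.DOmega ω d, GaborWF.IsLocalization a ψ γ u v) ∧
      ∀ v : GaborWF.DOmega ω d, GaborWF.IsLocalization a ψ γ u v →
        ∀ φ θ : GaborWF.SOmega ω d, φ ≠ 0 → θ ≠ 0 →
          GaborWF.waveFrontSet φ v ⊆ GaborWF.waveFrontSet θ u := by
  obtain ⟨B, μ, hB, hμ, hu⟩ := GaborWF.exists_norm_stft_le ψ u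
  have hF : AEStronglyMeasurable fun z => a z * GaborWF.stft ψ u z :=
    ha.aestronglyMeasurable.mul (GaborWF.continuous_stft ψ u).aestronglyMeasurable
  have hle : ∀ z, ‖a z * GaborWF.stft ψ u z‖ ≤ C * B * Real.exp ((τ + μ) * ω.phase z) := by
    intro z
    rw [norm_mul, add_mul, Real.exp_add]
    calc _ ≤ (C * Real.exp (τ * ω.phase z)) * (B * Real.exp (μ * ω.phase z)) := by
          gcongr
          · exact hbound z
          · exact hu z
      _ = _ := by ring
  have hτμ : 0 ≤ τ + μ := by positivity
  refine ⟨?_, fun v hv φ θ _ hθ z₀ hz₀ => ?_⟩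
  · obtain ⟨v, hv⟩ := GaborWF.exists_isAdjointSTFT hF hτμ hle γ
    exact ⟨v, hv, fun v' hv' => GaborWF.IsAdjointSTFT.unique hv' hv⟩
  · by_contra hn
    -- Rapid decay near `z₀` passes from the window `θ` to `ψ`, survives multiplication by `a`, and
    -- is carried through `V_γ^*` to the transform with window `φ`; the cone may shrink at the first
    -- and last of these steps.
    obtain ⟨Γ, hΓ, hzΓ, h⟩ := (GaborWF.not_mem_waveFrontSet_iff hz₀.1).1 hn
    obtain ⟨Γ₁, hΓ₁, hz₁, h₁⟩ := GaborWF.exists_rapidOn_stft hθ hΓ h hzΓ ψ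
    obtain ⟨Γ₂, hΓ₂, hz₂, h₂⟩ := GaborWF.IsAdjointSTFT.exists_rapidOn hv hτμ hle hΓ₁
      (h₁.mul_of_growth hτ hC hbound) hz₁ φ
    exact (GaborWF.not_mem_waveFrontSet_iff hz₀.1).2 ⟨Γ₂, hΓ₂, hz₂, h₂⟩ hz₀
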